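/- Let $\epsilon=e^{\pi i/4}$ and, on $\mathbf{C}\smallsetminus -i[0,\infty)$, put $f(z)=1+\frac14 z^{-5/2}$ with $\arg z\in(-\frac{\pi}{2},\frac{3\pi}{2}]$, and for $\tau>0$ $$\varphi(z)=\varphi(z,\tau)=-\pi z-\frac{\pi}{4z}+\frac12\Bigl(\frac12+\frac{2\pi i}{\tau^{2}}\Bigr)\log(1-iz),$$ with the principal logarithm of $1-iz$. For all sufficiently small $\tau>0$ there is exactly one saddle $q_2=q_2(\tau)$ (a solution of $\varphi'(q_2)=0$) with $|q_2-\frac{i\tau}{2}|<\frac{\tau}{10}$. Put $$J_2(\tau)=2\pi\int_{q_2^-}^{q_2^+}f(z)e^{\varphi(z)}\,dz,\qquad q_2^{\pm}=q_2\pm\tfrac14\epsilon^3\tau,$$ the integral being along the straight segment. Define $E(\tau)$, $A_n(\tau)$ $(n\ge2)$ and $B_n(\tau)$ $(n\ge0)$ by $$e^{\varphi(q_2)}=\exp\Bigl\{\pi i\Bigl(\frac1\tau-\frac18\Bigr)\Bigr\}E(\tau),\qquad \frac{\varphi^{(n)}(q_2)}{n!}=\frac{\pi}{4}\Bigl(\frac{2i}{\tau}\Bigr)^{n+1}A_n(\tau),\qquad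 \frac{f^{(n)}(q_2)}{n!}=\frac14\binom{-5/2}{n}\Bigl(\frac{i\tau}{2}\Bigr)^{-5/2-n}B_n(\tau).$$ Let $c_{n,k}=c_{n,k}(\tau)$ be the coefficients in the formal expansion $$\Bigl(\sum_{n\ge0}B_n\binom{-5/2}{n}(2\epsilon x)^n\Bigr)\exp\Bigl(w\,\frac{\pi i}{2}\sum_{n\ge3}A_n\Bigl(\frac{2}{\epsilon^{3}}\Bigr)^{n}x^{n-2}\Bigr)=\sum_{n\ge0}\Bigl(\sum_{k=0}^{n}c_{n,k}w^k\Bigr)x^n,$$ and let $F(\tau)=\sum_{n\ge0}F_n(\tau)\tau^n$ be the formal series with $$F_n(\tau)=\frac{1}{\sqrt{\pi}\,B_0}\sum_{k=0}^{2n}\Gamma\bigl(n+k+\tfrac12\bigr)\frac{c_{2n,k}}{(2\pi A_2)^{n+k}}.$$ **Proposition.** As $\tau\to0^+$ we have the generalized asymptotic expansion $$J_2(\tau)\asymp\frac{2\pi}{\tau}\exp\Bigl\{\pi i\Bigl(\frac1\tau-\frac58\Bigr)\Bigr\}\frac{B_0EF}{\sqrt{A_2}},$$ that is, for every integer $N\ge0$,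 $$J_2(\tau)=\frac{2\pi}{\tau}\exp\Bigl\{\pi i\Bigl(\frac1\tau-\frac58\Bigr)\Bigr\}\frac{B_0(\tau)E(\tau)}{\sqrt{A_2(\tau)}}\sum_{n=0}^{N-1}F_n(\tau)\tau^n+O(\tau^{N-1}),$$ with the principal square root. Here, for small $\tau>0$, the functions $E$, $A_n$ $(n\ge2)$ and $B_n$ $(n\ge1)$ are convergent power series in $\tau$ with constant term $1$, $B_0$ is a convergent power series in $\tau^{1/2}$ with constant term $1$, and every $F_n$ is a convergent power series in $\tau^{1/2}$. Moreover $$E=1+\Bigl(\frac18-\frac{47i\pi}{96}\Bigr)\tau+\frac{144-3432i\pi-2209\pi^2}{18432}\tau^2+O(\tau^3),\qquad A_2=1-\tau+\Bigl(-\frac{31}{32}-\frac{3i}{8\pi}\Bigr)\tau^2+O(\tau^3),$$ $$B_0=1-\frac58\tau-\frac{5(27\pi+8i)}{128\pi}\tau^2-\Bigl(\frac12+\frac i2\Bigr)\tau^{5/2}+O(\tau^3),$$ and, for all sufficiently small $\tau>0$, $F_0=1$, $$F_1=-\frac{15iA_3B_1}{4\pi A_2^2B_0}+\frac{35iB_2}{8\pi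 A_2B_0}+\frac{15iA_3^2}{8\pi A_2^3}-\frac{3iA_4}{2\pi A_2^2},$$ $$\begin{aligned}F_2={}&\frac{1575A_3^3B_1}{32\pi^2A_2^5B_0}-\frac{3675A_3^2B_2}{64\pi^2A_2^4B_0}-\frac{525A_4A_3B_1}{8\pi^2A_2^4B_0}+\frac{1575A_3B_3}{32\pi^2A_2^3B_0}+\frac{75A_5B_1}{4\pi^2A_2^3B_0}+\frac{525A_4B_2}{16\pi^2A_2^3B_0}\\&-\frac{3465B_4}{128\pi^2A_2^2B_0}-\frac{3465A_3^4}{128\pi^2A_2^6}+\frac{945A_4A_3^2}{16\pi^2A_2^5}-\frac{105A_5A_3}{4\pi^2A_2^4}-\frac{105A_4^2}{8\pi^2A_2^4}+\frac{15A_6}{2\pi^2A_2^3}.\end{aligned}$$ -/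

import Mathlib

open Filter Topology Asymptotics Complex

namespace NaiveIntegral

noncomputable section

/-- The logarithm on the plane cut along the negative imaginary axis,
with argument in `(-π/2, 3π/2]`. -/
def cutLog (z : ℂ) : ℂ := Complex.log (z / I) + Real.pi * I / 2

/-- The power `z ^ a` determined by `cutLog`. -/
def cutPow (z a : ℂ) : ℂ := Complex.exp (a * cutLog z)

/-- The amplitude `f(z) = 1 + z^{-5/2} / 4`. -/
def f (z : ℂ) : ℂ := 1 + 1 / 4 * cutPow z (-5 / 2)

/-- The phase `φ(z) = -π z - π/(4z) + (1/2) (1/2 + 2πi/τ²) log(1 - iz)`. The principal logarithm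
of `1 - iz` is holomorphic on the plane cut along the negative imaginary axis. -/
def phase (τ : ℝ) (z : ℂ) : ℂ :=
  -Real.pi * z - Real.pi / (4 * z)
    + (1 / 2 + 2 * Real.pi * I / (τ : ℂ) ^ 2) / 2 * Complex.log (1 - I * z)

/-- `q` is a saddle of the phase and lies in the disc `|q - iτ/2| < τ/10`. -/
def IsSecondSaddle (τ : ℝ) (q : ℂ) : Prop :=
  deriv (phase τ) q = 0 ∧ ‖q - I * τ / 2‖ < τ / 10

/-- The second saddle `q₂(τ)`. -/
def q₂ (τ : ℝ) : ℂ := Classical.epsilon (IsSecondSaddle τ)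

/-- `ε = e^{πi/4}`. -/
def eps : ℂ := Complex.exp (Real.pi * I / 4)

/-- The integral of `g` along the straight segment from `a` to `b`. -/
def segmentIntegral (g : ℂ → ℂ) (a b : ℂ) : ℂ :=
  ∫ t in (0 : ℝ)..1, g (a + t * (b - a)) * (b - a)

/-- The left end `q₂⁻ = q₂ - ε³ τ / 4`. -/
def q₂Minus (τ : ℝ) : ℂ := q₂ τ - eps ^ 3 * τ / 4

/-- The right end `q₂⁺ = q₂ + ε³ τ / 4`. -/
def q₂Plus (τ : ℝ) : ℂ := q₂ τ + eps ^ 3 * τ / 4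

/-- `J₂(τ) = 2π ∫ f(z) e^{φ(z)} dz` along the segment from `q₂⁻` to `q₂⁺`. -/
def J₂ (τ : ℝ) : ℂ :=
  2 * Real.pi *
    segmentIntegral (fun z => f z * Complex.exp (phase τ z)) (q₂Minus τ) (q₂Plus τ)

/-- `E(τ)`, defined by `e^{φ(q₂)} = exp(πi(1/τ - 1/8)) E(τ)`. -/
def E (τ : ℝ) : ℂ :=
  Complex.exp (phase τ (q₂ τ)) / Complex.exp (Real.pi * I * (1 / τ - 1 / 8))

/-- The normalized Taylor coefficients of the phase at the saddle:
`φ(z) = φ(q₂) + (π/4) ∑_{n ≥ 2} A_n (2i/τ)^{n+1} (z - q₂)^n`. -/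
def A (n : ℕ) (τ : ℝ) : ℂ :=
  4 * iteratedDeriv n (phase τ) (q₂ τ)
    / (Real.pi * (2 * I / (τ : ℂ)) ^ (n + 1) * (n.factorial : ℂ))

/-- The normalized Taylor coefficients of the amplitude at the saddle:
`f(z) = (1/4) ∑_{n ≥ 0} B_n binom(-5/2, n) (iτ/2)^{-5/2-n} (z - q₂)^n`. -/
def B (n : ℕ) (τ : ℝ) : ℂ :=
  4 * iteratedDeriv n f (q₂ τ)
    / ((n.factorial : ℂ) * Ring.choose (-5 / 2 : ℂ) n * cutPow (I * τ / 2) (-5 / 2 - n))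

/-- The power series `∑_{n ≥ 0} B_n binom(-5/2, n) (2 ε x)^n` in `x`. -/
def ampSeries (τ : ℝ) : PowerSeries ℂ :=
  PowerSeries.mk fun n => B n τ * Ring.choose (-5 / 2 : ℂ) n * (2 * eps) ^ n

/-- The power series `(πi/2) ∑_{n ≥ 3} A_n (2/ε³)^n x^{n-2}` in `x`. -/
def expSeries (τ : ℝ) : PowerSeries ℂ :=
  PowerSeries.mk fun m =>
    if m = 0 then 0 else Real.pi * I / 2 * A (m + 2) τ * (2 / eps ^ 3) ^ (m + 2)

/-- `c_{n,k}`: the coefficient of `x^n w^k` in `ampSeries * exp (w * expSeries)`. -/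
def c (n k : ℕ) (τ : ℝ) : ℂ :=
  PowerSeries.coeff n (ampSeries τ * expSeries τ ^ k) / (k.factorial : ℂ)

/-- The coefficient `F_n` of `F(τ) = ∑ F_n τ^n`. It comes from
`∫ x^{2n} (x²/τ)^k e^{-a x²/τ} dx = Γ(n+k+1/2) τ^{n+1/2} / a^{n+k+1/2}` with `a = 2π A₂`, applied
to the terms `c_{2n,k}`, after division by the leading term `B₀ √(τ/(2A₂))`. -/
def F (n : ℕ) (τ : ℝ) : ℂ :=
  (∑ k ∈ Finset.range (2 * n + 1),
      (Real.Gamma (n + k + 1 / 2) : ℂ) * c (2 * n) k τ / (2 * Real.pi * A 2 τ) ^ (n + k))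
    / ((Real.sqrt Real.pi : ℂ) * B 0 τ)

/-- For small `τ > 0`, `u(τ)` is the sum of a convergent power series in `p(τ)` with constant
term `c₀`. -/
def IsSeriesIn (p : ℝ → ℝ) (c₀ : ℂ) (u : ℝ → ℂ) : Prop :=
  ∃ g : ℂ → ℂ, AnalyticAt ℂ g 0 ∧ g 0 = c₀ ∧ ∀ᶠ τ in 𝓝[>] (0 : ℝ), u τ = g (p τ)

end

end NaiveIntegral

namespace NaiveIntegral

noncomputable section

/-! With z = is the saddle equation becomes 4s² = τ²P(s), where P(0) = 1. Its square root τ =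
2sP(s)^{-1/2} is a local biholomorphism at 0 (`saddleParam`), so the saddle is i times an analytic
function of τ (`saddleInv`); the small disc excludes the opposite sign of the root
(`eventually_isSecondSaddle_iff`). The factors of the answer are explicit in s, τ and L = log P(s):
see `SaddleData.A_eq`, `SaddleData.B_eq`, `SaddleData.E_eq`. This yields convergence, and the first
terms follow by expanding in s and eliminating s in favour of τ. Half-integral powers come only from
the summand 1 of f, which only B_0 sees.

For the integral put z = q₂ + ε³τx with |x| ≤ 1/4. Since φ'(q₂) = 0, Taylor's formula gives φ(z) =
φ(q₂) + w(q(x) - a) with w = x²/τ, a = 2πA_2 and q(0) = 0, while f becomes a constant times a series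
p(x); p and q are `ampSeries` and `expSeries`. The variables x and w are then treated as
independent: p exp(wq) is truncated below degree 2N in each of them, and the truncation times
e^{-aw} is integrated over the whole line, where Gaussian moments produce the F_n. The error is at
most a constant times |x|^{2N}(1+w)^{2N}e^{-w/2}, and |x|^{2N} = τ^N w^N makes its integral O(τ^N√τ)
(`laplace_expansion`). The prefactor is of size τ^{-3/2}, whence O(τ^{N-1}) in `J₂_expansion`.

Because p, q and a depend on τ, two uniform facts are needed: a bound for a weighted ℓ¹ norm of the
coefficients (`WBound`), and Re(a - q(x)) ≥ 1/2 on the whole segment. The second holds because every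
A_n tends to 1, so that a - q(x) is close to 2π/(1 + 2εx), whose real part is bounded below
(`eventually_re_evalSeries_le`). -/

/-! ### The saddle as an analytic function of τ. -/

/-- In the variable `s = -iz` the saddle equation reads `4 s² = τ² saddlePoly s`. -/
def saddlePoly (s : ℂ) : ℂ := (1 + s) * (1 + 4 * s ^ 2) + I * s ^ 2 / Real.pi

/-- The logarithm of `saddlePoly`, analytic near `0`. -/
def saddleLog (s : ℂ) : ℂ := log (saddlePoly s)

/-- The parameter `τ` as a function of the saddle. -/
def saddleParam (s : ℂ) : ℂ := 2 * s * exp (-(saddleLog s) / 2)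

lemma saddlePoly_zero : saddlePoly 0 = 1 := by simp [saddlePoly]

lemma saddleLog_zero : saddleLog 0 = 0 := by simp [saddleLog, saddlePoly_zero]

lemma analyticAt_saddlePoly (s : ℂ) : AnalyticAt ℂ saddlePoly s := by
  unfold saddlePoly
  fun_prop

lemma analyticAt_saddleLog : AnalyticAt ℂ saddleLog 0 :=
  (analyticAt_saddlePoly 0).clog (by simp [saddlePoly_zero])

lemma analyticAt_saddleParam : AnalyticAt ℂ saddleParam 0 := by
  have := analyticAt_saddleLog
  unfold saddleParam
  fun_prop

lemma saddleParam_zero : saddleParam 0 = 0 := by simp [saddleParam]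

lemma hasDerivAt_saddleParam : HasDerivAt saddleParam 2 0 := by
  have h1 : HasDerivAt (fun s : ℂ => 2 * s) 2 0 := by
    simpa using (hasDerivAt_id (0 : ℂ)).const_mul 2
  have h2 := ((analyticAt_saddleLog.differentiableAt.hasDerivAt.neg).div_const 2).cexp
  have := h1.mul h2
  simpa [saddleLog_zero] using! this

lemma exp_saddleLog : ∀ᶠ s in 𝓝 (0 : ℂ), exp (saddleLog s) = saddlePoly s := by
  have h : ∀ᶠ s in 𝓝 (0 : ℂ), saddlePoly s ≠ 0 :=
    (analyticAt_saddlePoly 0).continuousAt.eventually_ne (by simp [saddlePoly_zero])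
  filter_upwards [h] with s hs using exp_log hs

/-- The saddle in the variable `s`, as an analytic function of `τ`. -/
lemma exists_saddleInv : ∃ h : ℂ → ℂ, AnalyticAt ℂ h 0 ∧ h 0 = 0 ∧ HasDerivAt h (1 / 2) 0 ∧
    (∀ᶠ s in 𝓝 (0 : ℂ), h (saddleParam s) = s) ∧ ∀ᶠ t in 𝓝 (0 : ℂ), saddleParam (h t) = t := by
  have hd : deriv saddleParam 0 ≠ 0 := by simp [hasDerivAt_saddleParam.deriv]
  have hs := analyticAt_saddleParam.hasStrictDerivAt
  have h1 := analyticAt_saddleParam.analyticAt_localInverse hd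
  have h2 := hs.eventually_left_inverse hd
  have h3 := hs.eventually_right_inverse hd
  have h4 := (hs.to_localInverse hd).hasDerivAt
  have h5 := h2.self_of_nhds
  rw [saddleParam_zero] at h1 h3 h4 h5
  refine ⟨_, h1, h5, ?_, h2, h3⟩
  simpa [hasDerivAt_saddleParam.deriv] using h4

def saddleInv : ℂ → ℂ := Classical.choose exists_saddleInv

lemma analyticAt_saddleInv : AnalyticAt ℂ saddleInv 0 := (Classical.choose_spec exists_saddleInv).1

lemma saddleInv_zero : saddleInv 0 = 0 := (Classical.choose_spec exists_saddleInv).2.1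

lemma hasDerivAt_saddleInv : HasDerivAt saddleInv (1 / 2) 0 :=
  (Classical.choose_spec exists_saddleInv).2.2.1

lemma saddleInv_saddleParam : ∀ᶠ s in 𝓝 (0 : ℂ), saddleInv (saddleParam s) = s :=
  (Classical.choose_spec exists_saddleInv).2.2.2.1

lemma saddleParam_saddleInv : ∀ᶠ t in 𝓝 (0 : ℂ), saddleParam (saddleInv t) = t :=
  (Classical.choose_spec exists_saddleInv).2.2.2.2

lemma tendsto_ofReal_nhdsGT : Tendsto (fun τ : ℝ => (τ : ℂ)) (𝓝[>] (0 : ℝ)) (𝓝 0) := by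
  have : Tendsto (fun τ : ℝ => (τ : ℂ)) (𝓝 0) (𝓝 ((0 : ℝ) : ℂ)) := continuous_ofReal.tendsto 0
  rw [ofReal_zero] at this
  exact this.mono_left nhdsWithin_le_nhds

lemma norm_saddleInv_sub_lt {δ : ℝ} (hδ : 0 < δ) :
    ∀ᶠ τ : ℝ in 𝓝[>] 0, ‖saddleInv τ - τ / 2‖ < δ * τ := by
  have h := hasDerivAt_saddleInv.isLittleO
  have h2 := (h.def (half_pos hδ))
  filter_upwards [tendsto_ofReal_nhdsGT.eventually h2, self_mem_nhdsWithin] with τ h3 hτ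
  have hτ : 0 < τ := hτ
  simp only [saddleInv_zero, sub_zero, smul_eq_mul, norm_real, Real.norm_eq_abs,
    abs_of_pos hτ] at h3
  rw [show (τ : ℂ) * (1 / 2) = τ / 2 by ring] at h3
  nlinarith

/-- The half plane on which `f` and the phase are holomorphic. -/
lemma isOpen_im_pos : IsOpen {z : ℂ | 0 < z.im} := isOpen_lt continuous_const continuous_im

lemma one_sub_I_mul_mem_slitPlane {z : ℂ} (hz : 0 < z.im) : 1 - I * z ∈ slitPlane := by
  left; simp; linarith

lemma div_I_mem_slitPlane {z : ℂ} (hz : 0 < z.im) : z / I ∈ slitPlane := by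
  left; simp [hz]

lemma ne_zero_of_im_pos {z : ℂ} (hz : 0 < z.im) : z ≠ 0 := by
  rintro rfl; simp at hz

lemma hasDerivAt_phase (τ : ℝ) {z : ℂ} (hz : 0 < z.im) :
    HasDerivAt (phase τ) (-Real.pi + Real.pi / (4 * z ^ 2)
      + (1 / 2 + 2 * Real.pi * I / (τ : ℂ) ^ 2) / 2 * (-I / (1 - I * z))) z := by
  have h0 := ne_zero_of_im_pos hz
  have h1 : HasDerivAt (fun z : ℂ => -Real.pi * z) (-Real.pi : ℂ) z := by
    simpa using (hasDerivAt_id z).const_mul (-Real.pi : ℂ)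
  have h2 : HasDerivAt (fun z : ℂ => (Real.pi : ℂ) / (4 * z)) (-(Real.pi / (4 * z ^ 2))) z := by
    have := ((hasDerivAt_id z).const_mul 4).fun_inv (by simpa using h0) |>.const_mul (Real.pi : ℂ)
    simp only [id] at this
    convert! this using 1
    field_simp
  have h3 : HasDerivAt (fun z : ℂ => log (1 - I * z)) (-I / (1 - I * z)) z := by
    have := (((hasDerivAt_id z).const_mul I).const_sub 1).clog (one_sub_I_mul_mem_slitPlane hz)
    simpa using this
  have h4 := (h1.sub h2).add (h3.const_mul ((1 / 2 + 2 * Real.pi * I / (τ : ℂ) ^ 2) / 2))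
  rw [sub_neg_eq_add] at h4
  exact h4

lemma deriv_phase_eq_zero_iff {τ : ℝ} (hτ : τ ≠ 0) {s : ℂ} (hs : 0 < s.re) :
    deriv (phase τ) (I * s) = 0 ↔ 4 * s ^ 2 = (τ : ℂ) ^ 2 * saddlePoly s := by
  have hs0 : s ≠ 0 := by rintro rfl; simp at hs
  have hs1 : 1 + s ≠ 0 := by
    intro h
    have := congrArg re h
    simp at this
    linarith
  have hτ' : (τ : ℂ) ≠ 0 := by exact_mod_cast hτ
  have hpi : (Real.pi : ℂ) ≠ 0 := by exact_mod_cast Real.pi_ne_zero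
  rw [(hasDerivAt_phase τ (by simpa using hs)).deriv]
  have h1 : 1 - I * (I * s) = 1 + s := by linear_combination -s * I_sq
  have h2 : (I * s) ^ 2 = -s ^ 2 := by linear_combination s ^ 2 * I_sq
  have key : -(Real.pi : ℂ) + Real.pi / (4 * (I * s) ^ 2)
      + (1 / 2 + 2 * Real.pi * I / (τ : ℂ) ^ 2) / 2 * (-I / (1 - I * (I * s)))
      = Real.pi / (4 * s ^ 2 * (1 + s) * τ ^ 2) * (4 * s ^ 2 - τ ^ 2 * saddlePoly s) := by
    rw [h1, h2, saddlePoly]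
    field_simp
    linear_combination (-16 * s ^ 2 * Real.pi) * I_sq
  rw [key, mul_eq_zero, sub_eq_zero, or_iff_right]
  simp [hpi, hs0, hs1, hτ]

/-- For small `τ > 0` the saddle near `iτ/2` is `i saddleInv τ`, and it is unique. -/
lemma eventually_isSecondSaddle_iff :
    ∀ᶠ τ in 𝓝[>] (0 : ℝ), ∀ q : ℂ, IsSecondSaddle τ q ↔ q = I * saddleInv τ := by
  have hexp : Tendsto (fun s : ℂ => exp (-(saddleLog s) / 2)) (𝓝 0) (𝓝 1) := by
    have : ContinuousAt (fun s : ℂ => exp (-(saddleLog s) / 2)) 0 := by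
      have := analyticAt_saddleLog.continuousAt
      fun_prop
    simpa [ContinuousAt, saddleLog_zero] using this
  have hsmall : ∀ᶠ s in 𝓝 (0 : ℂ), saddleInv (saddleParam s) = s ∧
      exp (saddleLog s) = saddlePoly s ∧ ‖exp (-(saddleLog s) / 2) - 1‖ < 1 / 10 :=
    saddleInv_saddleParam.and (exp_saddleLog.and
      ((Metric.tendsto_nhds.1 hexp (1 / 10) (by norm_num)).mono fun s hs => by simpa [dist_eq] using hs))
  obtain ⟨r, hr, hball⟩ := Metric.eventually_nhds_iff.1 hsmall
  filter_upwards [norm_saddleInv_sub_lt (δ := 1 / 10) (by norm_num : (0 : ℝ) < 1 / 10), self_mem_nhdsWithin,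
    tendsto_ofReal_nhdsGT.eventually saddleParam_saddleInv,
    Ioo_mem_nhdsGT (show (0 : ℝ) < r by exact hr)] with τ hτ1 hτ hinv hτr q
  have hτ : 0 < τ := hτ
  have hτ0 : (τ : ℂ) ≠ 0 := by exact_mod_cast hτ.ne'
  obtain ⟨s, rfl⟩ : ∃ s, q = I * s := ⟨-I * q, by linear_combination q * I_sq⟩
  have hnorm : ‖I * s - I * τ / 2‖ = ‖s - τ / 2‖ := by
    rw [show I * s - I * τ / 2 = I * (s - τ / 2) by ring]; simp
  have hgood : ∀ s : ℂ, ‖s - τ / 2‖ < τ / 10 → 0 < s.re ∧ ‖s‖ < r := by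
    intro s hs
    have h1 := (abs_re_le_norm _).trans_lt hs
    have h2 : ‖(τ / 2 : ℂ)‖ = τ / 2 := by
      rw [norm_div, norm_real, Real.norm_eq_abs, abs_of_pos hτ]; norm_num
    have h3 := norm_le_norm_add_norm_sub' s (τ / 2 : ℂ)
    rw [h2] at h3
    have h4 : (s - τ / 2).re = s.re - τ / 2 := by simp
    rw [h4, abs_lt] at h1
    constructor
    · linarith
    · have := hτr.2; linarith
  have hsq : ∀ s : ℂ, exp (saddleLog s) = saddlePoly s →
      saddleParam s ^ 2 * saddlePoly s = 4 * s ^ 2 := by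
    intro s hs
    rw [← hs, saddleParam, mul_pow, ← exp_nat_mul, mul_assoc, ← exp_add]
    rw [show ((2 : ℕ) : ℂ) * (-(saddleLog s) / 2) + saddleLog s = 0 by push_cast; ring, exp_zero]
    ring
  have hIne : (I : ℂ) ≠ 0 := I_ne_zero
  constructor
  · rintro ⟨hd, hdist⟩
    rw [hnorm] at hdist
    obtain ⟨hre, hlt⟩ := hgood s hdist
    obtain ⟨h1, h2, h3⟩ := hball (y := s) (by simpa [dist_eq] using hlt)
    rw [deriv_phase_eq_zero_iff hτ.ne' hre] at hd
    have hP : saddlePoly s ≠ 0 := by rw [← h2]; exact exp_ne_zero _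
    have h4 : saddleParam s ^ 2 = (τ : ℂ) ^ 2 :=
      mul_right_cancel₀ hP ((hsq s h2).trans hd)
    rcases sq_eq_sq_iff_eq_or_eq_neg.1 h4 with h5 | h5
    · rw [← h5, h1]
    -- The wrong root: τ = -2s exp(-L/2), although 2s exp(-L/2) is close to 2s and 2s to τ. Writing
    -- 2τ as the sum of the two deviations bounds it by τ/5 + τ/5.
    · exfalso
      have h6 : (τ : ℂ) + τ = -(2 * (s - τ / 2)) - 2 * s * (exp (-(saddleLog s) / 2) - 1) := by
        rw [saddleParam] at h5
        linear_combination h5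
      have h7 : ‖(τ : ℂ) + τ‖ = 2 * τ := by
        rw [← two_mul, norm_mul, norm_real, Real.norm_eq_abs, abs_of_pos hτ]; norm_num
      have h8 : ‖s‖ ≤ τ := by
        have h2 : ‖(τ / 2 : ℂ)‖ = τ / 2 := by
          rw [norm_div, norm_real, Real.norm_eq_abs, abs_of_pos hτ]; norm_num
        have h3 := norm_le_norm_add_norm_sub' s (τ / 2 : ℂ)
        linarith
      have h9 : ‖-(2 * (s - τ / 2)) - 2 * s * (exp (-(saddleLog s) / 2) - 1)‖
          ≤ 2 * ‖s - τ / 2‖ + 2 * ‖s‖ * ‖exp (-(saddleLog s) / 2) - 1‖ := by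
        refine (norm_sub_le _ _).trans ?_
        simp
      rw [← h6, h7] at h9
      nlinarith [norm_nonneg s]
  · intro h
    have h := mul_left_cancel₀ hIne h
    have hdist : ‖s - τ / 2‖ < τ / 10 := by rw [h]; linarith
    obtain ⟨hre, hlt⟩ := hgood s hdist
    obtain ⟨h1, h2, h3⟩ := hball (y := s) (by simpa [dist_eq] using hlt)
    refine ⟨?_, by rwa [hnorm]⟩
    rw [deriv_phase_eq_zero_iff hτ.ne' hre, ← hsq s h2, h, hinv]

lemma eventually_existsUnique_isSecondSaddle :
    ∀ᶠ τ in 𝓝[>] (0 : ℝ), ∃! q : ℂ, IsSecondSaddle τ q := by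
  filter_upwards [eventually_isSecondSaddle_iff] with τ hτ
  exact ⟨I * saddleInv τ, (hτ _).2 rfl, fun q hq => (hτ q).1 hq⟩

lemma eventually_q₂_eq : ∀ᶠ τ in 𝓝[>] (0 : ℝ), q₂ τ = I * saddleInv τ := by
  filter_upwards [eventually_isSecondSaddle_iff] with τ hτ
  exact (hτ _).1 (Classical.epsilon_spec ⟨_, (hτ _).2 rfl⟩)

/-! ### Closed forms for the higher derivatives of the phase and the amplitude. -/

lemma hasDerivAt_inv_pow {u : ℂ → ℂ} {u' z : ℂ} (hu : HasDerivAt u u' z) (h0 : u z ≠ 0) (j : ℕ) :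
    HasDerivAt (fun z => (u z ^ (j + 1))⁻¹) (-((j : ℂ) + 1) * u' * (u z ^ (j + 2))⁻¹) z := by
  have h := (hu.fun_pow (j + 1)).fun_inv (pow_ne_zero _ h0)
  refine h.congr_deriv ?_
  simp only [Nat.add_sub_cancel]
  push_cast
  field_simp
  ring

/-- The offset k is there because the uniform formulas begin late: at order 2 for the phase, once
the linear term and the logarithm are gone, and at order 1 for f, once the constant 1 is gone. -/
lemma iteratedDeriv_eqOn_of_hasDerivAt {g : ℂ → ℂ} {G : ℕ → ℂ → ℂ} {U : Set ℂ} (hU : IsOpen U)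
    {k : ℕ} (h0 : ∀ z ∈ U, iteratedDeriv k g z = G 0 z)
    (hG : ∀ m, ∀ z ∈ U, HasDerivAt (G m) (G (m + 1) z) z) (m : ℕ) :
    ∀ z ∈ U, iteratedDeriv (m + k) g z = G m z := by
  induction m with
  | zero => simpa using h0
  | succ m ih =>
    intro z hz
    rw [show m + 1 + k = (m + k) + 1 by omega, iteratedDeriv_succ]
    have : iteratedDeriv (m + k) g =ᶠ[𝓝 z] G m := by
      filter_upwards [hU.mem_nhds hz] with w hw using ih w hw
    rw [this.deriv_eq, (hG m z hz).deriv]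

lemma hasDerivAt_one_sub_I_mul (z : ℂ) : HasDerivAt (fun z : ℂ => 1 - I * z) (-I) z := by
  simpa using ((hasDerivAt_id z).const_mul I).const_sub 1

lemma iteratedDeriv_phase (τ : ℝ) (m : ℕ) {z : ℂ} (hz : 0 < z.im) :
    iteratedDeriv (m + 2) (phase τ) z = (m + 2).factorial *
      (-(Real.pi / 4 * (-1) ^ m * (z ^ (m + 3))⁻¹)
        - (1 / 2 + 2 * Real.pi * I / (τ : ℂ) ^ 2) / 2 * (I ^ (m + 2) / (m + 2))
          * ((1 - I * z) ^ (m + 2))⁻¹) := by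
  set K : ℂ := (1 / 2 + 2 * Real.pi * I / (τ : ℂ) ^ 2) / 2 with hK
  refine iteratedDeriv_eqOn_of_hasDerivAt (U := {z | 0 < z.im})
    (G := fun m z => ((m + 2).factorial : ℂ) * (-(Real.pi / 4 * (-1) ^ m * (z ^ (m + 3))⁻¹)
        - K * (I ^ (m + 2) / (m + 2)) * ((1 - I * z) ^ (m + 2))⁻¹)) isOpen_im_pos ?_ ?_ m z hz
  · intro z hz
    rw [iteratedDeriv_succ, iteratedDeriv_one]
    have h1 : deriv (phase τ) =ᶠ[𝓝 z] fun z => -Real.pi + Real.pi / 4 * (z ^ (1 + 1))⁻¹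
        + K * (-I * ((1 - I * z) ^ (0 + 1))⁻¹) := by
      filter_upwards [isOpen_im_pos.mem_nhds hz] with w hw
      rw [(hasDerivAt_phase τ hw).deriv]
      field_simp
      ring
    have h2 := (hasDerivAt_inv_pow (hasDerivAt_id z) (ne_zero_of_im_pos hz) 1).const_mul
      (Real.pi / 4 : ℂ)
    have h3 := ((hasDerivAt_inv_pow (hasDerivAt_one_sub_I_mul z)
      (slitPlane_ne_zero (one_sub_I_mul_mem_slitPlane hz)) 0).const_mul (-I)).const_mul K
    rw [h1.deriv_eq]
    refine ((h2.const_add (-Real.pi : ℂ)).add h3).deriv.trans ?_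
    simp only [id, Nat.factorial, Nat.cast_one, Nat.cast_zero]
    push_cast
    ring
  · intro m z hz
    have h2 := (hasDerivAt_inv_pow (hasDerivAt_id z) (ne_zero_of_im_pos hz) (m + 2)).const_mul
      (Real.pi / 4 * (-1) ^ m : ℂ)
    have h3 := (hasDerivAt_inv_pow (hasDerivAt_one_sub_I_mul z)
      (slitPlane_ne_zero (one_sub_I_mul_mem_slitPlane hz)) (m + 1)).const_mul
      (K * (I ^ (m + 2) / (m + 2)))
    refine ((h2.neg.sub h3).const_mul ((m + 2).factorial : ℂ)).congr_deriv ?_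
    have h4 : ((m : ℂ) + 2) ≠ 0 := by norm_cast
    have h5 : ((m : ℂ) + 3) ≠ 0 := by norm_cast
    have h6 : ((m : ℂ) + 1 + 2) ≠ 0 := by norm_cast
    have e1 : ((m + 1 + 2).factorial : ℂ) = (m + 3) * (m + 2).factorial := by
      rw [show m + 1 + 2 = (m + 2) + 1 by omega, Nat.factorial_succ]
      push_cast
      ring
    have e2 : (-1 : ℂ) ^ (m + 1) = -(-1) ^ m := by ring
    have e3 : I ^ (m + 1 + 2) = I ^ (m + 2) * I := by ring
    have e4 : z ^ (m + 1 + 3) = z ^ (m + 2 + 2) := by ring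
    rw [e1, e2, e3, e4]
    simp only [id]
    push_cast
    generalize (z ^ (m + 2 + 2))⁻¹ = X
    generalize ((1 - I * z) ^ (m + 1 + 2))⁻¹ = Y
    rw [show (m : ℂ) + 1 + 2 = m + 3 by ring]
    field_simp
    ring

lemma exp_cutLog {z : ℂ} (hz : z ≠ 0) : exp (cutLog z) = z := by
  rw [cutLog, exp_add, exp_log (div_ne_zero hz I_ne_zero), mul_comm (Real.pi : ℂ) I,
    mul_div_assoc, mul_comm I, exp_pi_div_two_mul_I]
  field_simp

lemma hasDerivAt_cutPow (a : ℂ) {z : ℂ} (hz : 0 < z.im) :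
    HasDerivAt (fun z => cutPow z a) (a * cutPow z (a - 1)) z := by
  have h0 := ne_zero_of_im_pos hz
  have h1 : HasDerivAt cutLog (1 / z) z := by
    have := ((hasDerivAt_id z).div_const I).clog (div_I_mem_slitPlane hz)
    refine (this.add_const (Real.pi * I / 2)).congr_deriv ?_
    simp only [id]
    field_simp
  refine (h1.const_mul a).cexp.congr_deriv ?_
  rw [cutPow, sub_mul, exp_sub, one_mul, exp_cutLog h0]
  ring

lemma succ_mul_choose_succ (r : ℂ) (n : ℕ) :
    ((n : ℂ) + 1) * Ring.choose r (n + 1) = (r - n) * Ring.choose r n := by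
  have h := Ring.choose_smul_choose r (Nat.le_succ n)
  simp only [Nat.succ_eq_add_one, Nat.choose_succ_self_right, add_tsub_cancel_left,
    Ring.choose_one_right, nsmul_eq_mul] at h
  push_cast at h
  rw [h, mul_comm]

lemma iteratedDeriv_f (m : ℕ) {z : ℂ} (hz : 0 < z.im) :
    iteratedDeriv (m + 1) f z = 1 / 4 * (((m + 1).factorial : ℂ) * Ring.choose (-5 / 2 : ℂ) (m + 1))
      * cutPow z (-5 / 2 - (m + 1 : ℕ)) := by
  refine iteratedDeriv_eqOn_of_hasDerivAt (U := {z | 0 < z.im})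
    (G := fun m z => 1 / 4 * (((m + 1).factorial : ℂ) * Ring.choose (-5 / 2 : ℂ) (m + 1))
      * cutPow z (-5 / 2 - (m + 1 : ℕ))) isOpen_im_pos ?_ ?_ m z hz
  · intro z hz
    rw [zero_add, iteratedDeriv_one]
    have := ((hasDerivAt_cutPow (-5 / 2) hz).const_mul (1 / 4)).const_add 1
    rw [show f = fun z => 1 + 1 / 4 * cutPow z (-5 / 2) from rfl, this.deriv]
    simp
    ring
  · intro m z hz
    refine ((hasDerivAt_cutPow _ hz).const_mul _).congr_deriv ?_
    have h := succ_mul_choose_succ (-5 / 2) (m + 1)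
    rw [Nat.factorial_succ (m + 1),
      show (-5 / 2 - ((m + 1 : ℕ) : ℂ) - 1) = -5 / 2 - ((m + 1 + 1 : ℕ) : ℂ) by push_cast; ring]
    push_cast at h ⊢
    linear_combination (-1 / 4 * ((m + 1).factorial : ℂ)
      * cutPow z (-5 / 2 - ((m : ℂ) + 1 + 1))) * h

/-! ### Calculus of truncated Taylor expansions. -/

/-- `u(s) = a + b s + c s² + O(s³)` as `s → 0`. -/
def HasJetThree (u : ℂ → ℂ) (a b c : ℂ) : Prop :=
  (fun s => u s - (a + b * s + c * s ^ 2)) =O[𝓝 0] fun s : ℂ => s ^ 3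

/-- `u(s) = a + b s + c s² + d s³ + O(s⁴)` as `s → 0`. -/
def HasJetFour (u : ℂ → ℂ) (a b c d : ℂ) : Prop :=
  (fun s => u s - (a + b * s + c * s ^ 2 + d * s ^ 3)) =O[𝓝 0] fun s : ℂ => s ^ 4

lemma isBigO_mul_of_continuousAt {u p : ℂ → ℂ} {l : ℂ → ℂ} (hu : u =O[𝓝 0] l)
    (hp : ContinuousAt p 0) : (fun s => u s * p s) =O[𝓝 0] l := by
  simpa using hu.mul (hp.isBigO_one (F := ℂ))

lemma isBigO_self_mul {l p : ℂ → ℂ} (hp : ContinuousAt p 0) :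
    (fun s => l s * p s) =O[𝓝 0] l := isBigO_mul_of_continuousAt (isBigO_refl _ _) hp

lemma isBigO_add_of_eq {u v w l : ℂ → ℂ} (hv : v =O[𝓝 0] l) (hw : w =O[𝓝 0] l)
    (h : ∀ s, u s = v s + w s) : u =O[𝓝 0] l := by
  rw [show u = fun s => v s + w s from funext h]
  exact hv.add hw

namespace HasJetFour

variable {u v : ℂ → ℂ} {a b c d a' b' c' d' : ℂ}

lemma congr (hu : HasJetFour u a b c d) (h : ∀ᶠ s in 𝓝 0, v s = u s) : HasJetFour v a b c d :=
  IsBigO.congr' hu (h.mono fun s hs => by simp [hs]) EventuallyEq.rfl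

lemma of_eq (hu : HasJetFour u a b c d) (h1 : a = a') (h2 : b = b') (h3 : c = c') (h4 : d = d') :
    HasJetFour u a' b' c' d' := by subst h1 h2 h3 h4; exact hu

lemma jetThree (hu : HasJetFour u a b c d) : HasJetThree u a b c := by
  have h1 : (fun s : ℂ => s ^ 4) =O[𝓝 0] fun s : ℂ => s ^ 3 := by
    exact (isBigO_self_mul (l := fun s : ℂ => s ^ 3) (p := fun s => s) (by fun_prop)).congr_left
      fun s => by ring
  have h2 : (fun s : ℂ => s ^ 3 * d) =O[𝓝 0] fun s : ℂ => s ^ 3 :=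
    isBigO_self_mul continuousAt_const
  exact isBigO_add_of_eq (IsBigO.trans hu h1) h2 fun s => by ring

lemma tendsto (hu : HasJetFour u a b c d) : Tendsto u (𝓝 0) (𝓝 a) := by
  have h1 : Tendsto (fun s : ℂ => s ^ 4) (𝓝 0) (𝓝 0) := by
    simpa using (continuous_pow 4 : Continuous fun s : ℂ => s ^ 4).tendsto 0
  have h2 := IsBigO.trans_tendsto hu h1
  have h3 : Tendsto (fun s : ℂ => a + b * s + c * s ^ 2 + d * s ^ 3) (𝓝 0) (𝓝 a) := by
    have : Continuous fun s : ℂ => a + b * s + c * s ^ 2 + d * s ^ 3 := by fun_prop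
    simpa using this.tendsto 0
  simpa using h2.add h3

lemma poly (a b c d : ℂ) : HasJetFour (fun s => a + b * s + c * s ^ 2 + d * s ^ 3) a b c d := by
  simp [HasJetFour, isBigO_zero]

lemma add (hu : HasJetFour u a b c d) (hv : HasJetFour v a' b' c' d') :
    HasJetFour (fun s => u s + v s) (a + a') (b + b') (c + c') (d + d') :=
  isBigO_add_of_eq hu hv fun s => by ring

lemma const_mul (hu : HasJetFour u a b c d) (k : ℂ) :
    HasJetFour (fun s => k * u s) (k * a) (k * b) (k * c) (k * d) := by
  refine (IsBigO.const_mul_left hu k).congr_left fun s => by ring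

lemma isBigO_one (hu : HasJetFour u a b c d) : u =O[𝓝 0] fun _ => (1 : ℂ) :=
  hu.tendsto.isBigO_one ℂ

lemma mul (hu : HasJetFour u a b c d) (hv : HasJetFour v a' b' c' d') :
    HasJetFour (fun s => u s * v s) (a * a') (a * b' + b * a') (a * c' + b * b' + c * a')
      (a * d' + b * c' + c * b' + d * a') := by
  have h1 : (fun s => (u s - (a + b * s + c * s ^ 2 + d * s ^ 3)) * v s) =O[𝓝 0]
      fun s : ℂ => s ^ 4 := by simpa using IsBigO.mul hu hv.isBigO_one
  have h2 : (fun s => (v s - (a' + b' * s + c' * s ^ 2 + d' * s ^ 3)) *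
      (a + b * s + c * s ^ 2 + d * s ^ 3)) =O[𝓝 0] fun s : ℂ => s ^ 4 :=
    isBigO_mul_of_continuousAt hv (by fun_prop)
  have h3 : (fun s : ℂ => s ^ 4 * (b * d' + c * c' + d * b' + (c * d' + d * c') * s + d * d' * s ^ 2))
      =O[𝓝 0] fun s : ℂ => s ^ 4 := isBigO_self_mul (by fun_prop)
  exact isBigO_add_of_eq (h1.add h2) h3 fun s => by ring

lemma isBigO_id (hu : HasJetFour u 0 b c d) : u =O[𝓝 0] fun s : ℂ => s := by
  have h1 : (fun s : ℂ => s ^ 4) =O[𝓝 0] fun s : ℂ => s := by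
    have := isBigO_self_mul (l := fun s : ℂ => s) (p := fun s => s ^ 3) (by fun_prop)
    exact this.congr_left fun s => by ring
  have h2 : (fun s : ℂ => s * (b + c * s + d * s ^ 2)) =O[𝓝 0] fun s : ℂ => s :=
    isBigO_self_mul (by fun_prop)
  exact isBigO_add_of_eq (IsBigO.trans hu h1) h2 fun s => by ring

/-- Composition with a function that has a third order expansion. -/
lemma comp (hu : HasJetFour u 0 b c d) {g : ℂ → ℂ} {g0 g1 g2 g3 : ℂ}
    (hg : HasJetFour g g0 g1 g2 g3) : HasJetFour (fun s => g (u s)) g0 (g1 * b)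
      (g1 * c + g2 * b ^ 2) (g1 * d + 2 * g2 * b * c + g3 * b ^ 3) := by
  have h1 := (IsBigO.comp_tendsto hg hu.tendsto).trans (hu.isBigO_id.pow 4)
  have h2 := ((poly g0 0 0 0).add (hu.const_mul g1)).add (((hu.mul hu).const_mul g2).add
    (((hu.mul hu).mul hu).const_mul g3))
  have h3 := isBigO_add_of_eq h1 h2 (u := fun s => g (u s) - (g0 + g1 * b * s
    + (g1 * c + g2 * b ^ 2) * s ^ 2 + (g1 * d + 2 * g2 * b * c + g3 * b ^ 3) * s ^ 3))
    (fun s => by simp only [Function.comp]; ring)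
  exact h3

lemma exp : HasJetFour exp 1 1 (1 / 2) (1 / 6) := by
  have h := exp_sub_sum_range_isBigO_pow 4
  refine h.congr_left fun s => ?_
  simp [Finset.sum_range_succ, Nat.factorial]
  ring

lemma log_one_add : HasJetFour (fun s => log (1 + s)) 0 1 (-1 / 2) (1 / 3) := by
  have h : (fun s : ℂ => log (1 + s) - logTaylor 4 s) =O[𝓝 0] fun s : ℂ => s ^ 4 := by
    refine IsBigO.of_bound 1 ?_
    filter_upwards [Metric.ball_mem_nhds (0 : ℂ) (show (0 : ℝ) < 1 / 2 by norm_num)] with s hs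
    have hs : ‖s‖ < 1 / 2 := by simpa using hs
    have h := norm_log_sub_logTaylor_le 3 (z := s) (by linarith)
    refine h.trans ?_
    have h1 : (1 - ‖s‖)⁻¹ ≤ 2 := by
      rw [inv_le_comm₀ (by linarith) (by norm_num)]
      linarith
    have h2 : 0 ≤ ‖s‖ ^ 4 := by positivity
    norm_num
    nlinarith
  refine h.congr_left fun s => ?_
  simp [logTaylor, Finset.sum_range_succ]
  ring

end HasJetFour

namespace HasJetThree

variable {u v : ℂ → ℂ} {a b c a' b' c' : ℂ}

lemma congr (hu : HasJetThree u a b c) (h : ∀ᶠ s in 𝓝 0, v s = u s) : HasJetThree v a b c :=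
  IsBigO.congr' hu (h.mono fun s hs => by simp [hs]) EventuallyEq.rfl

lemma of_eq (hu : HasJetThree u a b c) (h1 : a = a') (h2 : b = b') (h3 : c = c') :
    HasJetThree u a' b' c' := by subst h1 h2 h3; exact hu

lemma tendsto (hu : HasJetThree u a b c) : Tendsto u (𝓝 0) (𝓝 a) := by
  have h1 : Tendsto (fun s : ℂ => s ^ 3) (𝓝 0) (𝓝 0) := by
    simpa using (continuous_pow 3 : Continuous fun s : ℂ => s ^ 3).tendsto 0
  have h2 := IsBigO.trans_tendsto hu h1
  have h3 : Tendsto (fun s : ℂ => a + b * s + c * s ^ 2) (𝓝 0) (𝓝 a) := by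
    have : Continuous fun s : ℂ => a + b * s + c * s ^ 2 := by fun_prop
    simpa using this.tendsto 0
  simpa using h2.add h3

lemma poly (a b c : ℂ) : HasJetThree (fun s => a + b * s + c * s ^ 2) a b c := by
  simp [HasJetThree, isBigO_zero]

lemma add (hu : HasJetThree u a b c) (hv : HasJetThree v a' b' c') :
    HasJetThree (fun s => u s + v s) (a + a') (b + b') (c + c') :=
  isBigO_add_of_eq hu hv fun s => by ring

lemma const_mul (hu : HasJetThree u a b c) (k : ℂ) :
    HasJetThree (fun s => k * u s) (k * a) (k * b) (k * c) := by
  refine (IsBigO.const_mul_left hu k).congr_left fun s => by ring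

lemma isBigO_one (hu : HasJetThree u a b c) : u =O[𝓝 0] fun _ => (1 : ℂ) :=
  hu.tendsto.isBigO_one ℂ

lemma mul (hu : HasJetThree u a b c) (hv : HasJetThree v a' b' c') :
    HasJetThree (fun s => u s * v s) (a * a') (a * b' + b * a') (a * c' + b * b' + c * a') := by
  have h1 : (fun s => (u s - (a + b * s + c * s ^ 2)) * v s) =O[𝓝 0]
      fun s : ℂ => s ^ 3 := by simpa using IsBigO.mul hu hv.isBigO_one
  have h2 : (fun s => (v s - (a' + b' * s + c' * s ^ 2)) *
      (a + b * s + c * s ^ 2)) =O[𝓝 0] fun s : ℂ => s ^ 3 :=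
    isBigO_mul_of_continuousAt hv (by fun_prop)
  have h3 : (fun s : ℂ => s ^ 3 * (b * c' + c * b' + c * c' * s))
      =O[𝓝 0] fun s : ℂ => s ^ 3 := isBigO_self_mul (by fun_prop)
  exact isBigO_add_of_eq (h1.add h2) h3 fun s => by ring

lemma isBigO_id (hu : HasJetThree u 0 b c) : u =O[𝓝 0] fun s : ℂ => s := by
  have h1 : (fun s : ℂ => s ^ 3) =O[𝓝 0] fun s : ℂ => s := by
    have := isBigO_self_mul (l := fun s : ℂ => s) (p := fun s => s ^ 2) (by fun_prop)
    exact this.congr_left fun s => by ring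
  have h2 : (fun s : ℂ => s * (b + c * s)) =O[𝓝 0] fun s : ℂ => s :=
    isBigO_self_mul (by fun_prop)
  exact isBigO_add_of_eq (IsBigO.trans hu h1) h2 fun s => by ring

lemma comp (hu : HasJetThree u 0 b c) {g : ℂ → ℂ} {g0 g1 g2 : ℂ}
    (hg : HasJetThree g g0 g1 g2) :
    HasJetThree (fun s => g (u s)) g0 (g1 * b) (g1 * c + g2 * b ^ 2) := by
  have h1 := (IsBigO.comp_tendsto hg hu.tendsto).trans (hu.isBigO_id.pow 3)
  have h2 := ((poly g0 0 0).add (hu.const_mul g1)).add ((hu.mul hu).const_mul g2)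
  exact isBigO_add_of_eq h1 h2 (u := fun s => g (u s) - (g0 + g1 * b * s
    + (g1 * c + g2 * b ^ 2) * s ^ 2))
    (fun s => by simp only [Function.comp]; ring)

end HasJetThree

lemma hasJetFour_saddleLog : HasJetFour saddleLog 0 1 (4 + I / Real.pi - 1 / 2)
    (4 - (4 + I / Real.pi) + 1 / 3) := by
  have h := (HasJetFour.poly 0 1 (4 + I / Real.pi) 4).comp HasJetFour.log_one_add
  refine (h.of_eq rfl (by ring) (by ring) (by ring)).congr (Eventually.of_forall fun s => ?_)
  rw [saddleLog, saddlePoly]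
  ring_nf

lemma hasJetFour_exp_saddleLog (k : ℂ) : HasJetFour (fun s => exp (k * saddleLog s)) 1 k
    (k * (4 + I / Real.pi - 1 / 2) + k ^ 2 / 2)
    (k * (4 - (4 + I / Real.pi) + 1 / 3) + k ^ 2 * (4 + I / Real.pi - 1 / 2) + k ^ 3 / 6) :=
  (((hasJetFour_saddleLog.const_mul k).of_eq (mul_zero k) rfl rfl rfl).comp HasJetFour.exp).of_eq
    rfl (by ring) (by ring) (by ring)

/-! ### The normalized coefficients in terms of s and L. -/

lemma tendsto_saddleInv : Tendsto (fun τ : ℝ => saddleInv τ) (𝓝[>] 0) (𝓝 0) := by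
  have := analyticAt_saddleInv.continuousAt.tendsto.comp tendsto_ofReal_nhdsGT
  rwa [saddleInv_zero] at this

lemma norm_ofReal_div_two {τ : ℝ} (hτ : 0 < τ) : ‖(τ / 2 : ℂ)‖ = τ / 2 := by
  rw [norm_div, norm_real, Real.norm_eq_abs, abs_of_pos hτ]
  norm_num

/-- The data of the saddle for small `τ`. -/
structure SaddleData (τ : ℝ) (s L : ℂ) : Prop where
  pos : 0 < τ
  lt : τ < 1 / 100
  q_eq : q₂ τ = I * s
  log_eq : L = saddleLog s
  param : (τ : ℂ) = 2 * s * exp (-L / 2)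
  near : ‖s - τ / 2‖ < τ / 100
  norm_lt : ‖L‖ < 1 / 100
  exp_eq : exp L = saddlePoly s
  pos_re : 0 < s.re

lemma eventually_saddleData :
    ∀ᶠ τ : ℝ in 𝓝[>] 0, SaddleData τ (saddleInv τ) (saddleLog (saddleInv τ)) := by
  have h1 : ∀ᶠ s in 𝓝 (0 : ℂ), ‖saddleLog s‖ < 1 / 100 := by
    have := analyticAt_saddleLog.continuousAt.norm
    rw [ContinuousAt, saddleLog_zero, norm_zero] at this
    exact this.eventually_lt_const (by norm_num)
  filter_upwards [self_mem_nhdsWithin, eventually_q₂_eq,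
    Ioo_mem_nhdsGT (show (0 : ℝ) < 1 / 100 by norm_num),
    tendsto_ofReal_nhdsGT.eventually saddleParam_saddleInv,
    norm_saddleInv_sub_lt (δ := 1 / 100) (by norm_num : (0 : ℝ) < 1 / 100),
    tendsto_saddleInv.eventually h1, tendsto_saddleInv.eventually exp_saddleLog]
    with τ h0 h2 hlt h3 h4 h5 h6
  have h0 : 0 < τ := h0
  have h7 := (abs_re_le_norm _).trans_lt h4
  rw [sub_re, show ((τ : ℂ) / 2).re = τ / 2 by simp, abs_lt] at h7
  exact ⟨h0, hlt.2, h2, rfl, h3.symm, by linarith, h5, h6, by linarith⟩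

namespace SaddleData

variable {τ : ℝ} {s L : ℂ}

lemma ne_zero (h : SaddleData τ s L) : s ≠ 0 := by
  rintro rfl
  simpa using h.pos_re

lemma tau_ne_zero (h : SaddleData τ s L) : (τ : ℂ) ≠ 0 := by
  exact_mod_cast h.pos.ne'

lemma im_pos (h : SaddleData τ s L) : 0 < (I * s).im := by simpa using h.pos_re

/-- The first summand comes from the pole -π/(4z), since (2i/τ)(is) = -2s/τ = -exp(L/2); the second
comes from the logarithm. The latter carries the factor τ^{m+1} because the large coefficient 2πi/τ²
is outweighed by the normalization (2i/τ)^{m+3}. -/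
lemma A_eq (h : SaddleData τ s L) (m : ℕ) :
    A (m + 2) τ = exp (-L / 2) ^ (m + 3) + (τ : ℂ) ^ (m + 1) * ((τ : ℂ) ^ 2 + 4 * Real.pi * I)
      / Real.pi * (I / ((m + 2) * 2 ^ (m + 3))) * ((1 + s) ^ (m + 2))⁻¹ := by
  have hs := h.ne_zero
  have hτ := h.tau_ne_zero
  have hpi : (Real.pi : ℂ) ≠ 0 := by exact_mod_cast Real.pi_ne_zero
  have hm : ((m : ℂ) + 2) ≠ 0 := by norm_cast
  have hfac : ((m + 2).factorial : ℂ) ≠ 0 := by exact_mod_cast Nat.factorial_ne_zero _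
  rw [A, h.q_eq, iteratedDeriv_phase τ m h.im_pos,
    show 1 - I * (I * s) = 1 + s by linear_combination -s * I_sq]
  generalize ((1 + s) ^ (m + 2))⁻¹ = Y
  have ha : exp (-L / 2) = -(((2 * I / τ) * (I * s))⁻¹) := by
    rw [show (2 * I / τ) * (I * s) = -(2 * s / τ) by
      field_simp; linear_combination I_sq, inv_neg, neg_neg, inv_div, eq_div_iff (by simpa using hs)]
    rw [h.param]; ring
  have ha2 : exp (-L / 2) ^ (m + 3)
      = -(-1) ^ m * ((I * s) ^ (m + 3))⁻¹ * ((2 * I / τ) ^ (m + 3))⁻¹ := by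
    rw [ha, neg_pow, inv_pow, mul_pow, mul_inv]
    ring
  rw [ha2]
  generalize ((I * s) ^ (m + 3))⁻¹ = X
  have e1 : (2 * I / (τ : ℂ)) ^ (m + 2 + 1) = 2 ^ (m + 3) * (I * I ^ (m + 2)) / τ ^ (m + 3) := by
    rw [div_pow, mul_pow]; ring
  have hI : I ^ (m + 2) ≠ 0 := pow_ne_zero _ I_ne_zero
  rw [e1, show (τ : ℂ) ^ (m + 3) = τ ^ (m + 1) * τ ^ 2 by ring]
  generalize I ^ (m + 2) = Z at *
  have hI2 := I_ne_zero
  field_simp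
  linear_combination (-4 * Y * Z * (τ ^ 2 + 4 * Real.pi * I)) * I_sq

/-- The saddle is (iτ/2)·exp(L/2), and L is small enough for the logarithms to add without a
multiple of 2πi. -/
lemma cutLog_sub (h : SaddleData τ s L) : cutLog (I * s) - cutLog (I * τ / 2) = L / 2 := by
  have h2 : (0 : ℝ) < τ / 2 := by linarith [h.pos]
  have hs : s = ((τ / 2 : ℝ) : ℂ) * exp (L / 2) := by
    have : exp (-L / 2) * exp (L / 2) = 1 := by
      rw [← exp_add]
      simp [neg_div]
    push_cast
    rw [h.param]
    linear_combination (-s) * this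
  have hL : |(L / 2).im| < Real.pi := by
    have h3 := abs_im_le_norm (L / 2)
    have h4 : ‖L / 2‖ < 1 := by
      rw [norm_div]
      norm_num
      linarith [h.norm_lt]
    linarith [Real.pi_gt_three]
  have e1 : I * s / I = s := by field_simp
  have e2 : I * τ / 2 / I = ((τ / 2 : ℝ) : ℂ) := by push_cast; field_simp
  rw [cutLog, cutLog, e1, e2, hs, log_ofReal_mul h2 (exp_ne_zero _),
    log_exp (by linarith [(abs_lt.1 hL).1]) (by linarith [(abs_lt.1 hL).2]), ofReal_log h2.le]
  ring

lemma cutPow_div (h : SaddleData τ s L) (a : ℂ) :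
    cutPow (I * s) a / cutPow (I * τ / 2) a = exp (a * (L / 2)) := by
  rw [cutPow, cutPow, ← exp_sub, ← mul_sub, h.cutLog_sub]

end SaddleData

lemma choose_ne_zero (n : ℕ) : Ring.choose (-5 / 2 : ℂ) n ≠ 0 := by
  induction n with
  | zero => simp
  | succ n ih =>
    intro h
    have h1 := succ_mul_choose_succ (-5 / 2) n
    rw [h, mul_zero, eq_comm, mul_eq_zero, or_iff_left ih] at h1
    have h2 := congrArg re h1
    simp at h2
    have : (0 : ℝ) ≤ n := n.cast_nonneg
    linarith

lemma cutPow_ne_zero (z a : ℂ) : cutPow z a ≠ 0 := exp_ne_zero _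

namespace SaddleData

variable {τ : ℝ} {s L : ℂ}

lemma B_eq (h : SaddleData τ s L) (n : ℕ) :
    B (n + 1) τ = exp ((-5 / 2 - (n + 1 : ℕ)) * (L / 2)) := by
  have hfac : ((n + 1).factorial : ℂ) ≠ 0 := by exact_mod_cast Nat.factorial_ne_zero _
  have hch := choose_ne_zero (n + 1)
  have hc := cutPow_ne_zero (I * τ / 2) (-5 / 2 - (n + 1 : ℕ))
  rw [B, h.q_eq, iteratedDeriv_f n h.im_pos, ← h.cutPow_div]
  generalize Ring.choose (-5 / 2 : ℂ) (n + 1) = C at *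
  generalize cutPow (I * τ / 2) (-5 / 2 - (n + 1 : ℕ)) = D at *
  field_simp

/-- The extra summand is the constant 1 of f, which differentiation removes from all later
coefficients. -/
lemma B_zero_eq (h : SaddleData τ s L) :
    B 0 τ = 4 / cutPow (I * τ / 2) (-5 / 2) + exp (-5 / 2 * (L / 2)) := by
  rw [B, h.q_eq, ← h.cutPow_div]
  have hc := cutPow_ne_zero (I * τ / 2) (-5 / 2)
  simp [f]
  field_simp

end SaddleData

lemma eps_eq : eps = (1 + I) / (Real.sqrt 2 : ℂ) := by
  have h2 : (Real.sqrt 2 : ℂ) ^ 2 = 2 := by exact_mod_cast Real.sq_sqrt (by norm_num : (0:ℝ) ≤ 2)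
  have h0 : (Real.sqrt 2 : ℂ) ≠ 0 := by
    intro h; rw [h] at h2; norm_num at h2
  rw [eps, show (Real.pi * I / 4 : ℂ) = ((Real.pi / 4 : ℝ) : ℂ) * I by push_cast; ring, exp_mul_I,
    ← ofReal_cos, ← ofReal_sin, Real.cos_pi_div_four, Real.sin_pi_div_four]
  push_cast
  field_simp
  linear_combination (1 + I) * h2

lemma eps_sq : eps ^ 2 = I := by
  rw [eps, ← exp_nat_mul, show ((2 : ℕ) : ℂ) * (Real.pi * I / 4) = Real.pi / 2 * I by
    push_cast; ring, exp_pi_div_two_mul_I]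

/-- On the chosen branch (iτ/2)^{5/2} = (τ/2)^{5/2}ε⁵, and ε⁵ = -ε. This is where τ^{1/2} enters. -/
lemma inv_cutPow_eq {τ : ℝ} (hτ : 0 < τ) :
    4 / cutPow (I * τ / 2) (-5 / 2) = -(1 + I) / 2 * (Real.sqrt τ : ℂ) ^ 5 := by
  have h2 : (0 : ℝ) < τ / 2 := by linarith
  have e2 : I * τ / 2 / I = ((τ / 2 : ℝ) : ℂ) := by push_cast; field_simp
  have hs2 : (Real.sqrt 2 : ℂ) ^ 2 = 2 := by
    exact_mod_cast Real.sq_sqrt (by norm_num : (0:ℝ) ≤ 2)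
  have h0 : (Real.sqrt 2 : ℂ) ≠ 0 := by
    intro h; rw [h] at hs2; norm_num at hs2
  have h3 : ((Real.sqrt (τ / 2) : ℝ) : ℂ) = exp (Real.log (τ / 2) / 2) := by
    rw [← Real.exp_log (Real.sqrt_pos.2 h2), Real.log_sqrt h2.le]
    push_cast
    rfl
  have h4 : (cutPow (I * τ / 2) (-5 / 2))⁻¹ = ((Real.sqrt (τ / 2) : ℝ) : ℂ) ^ 5 * eps ^ 5 := by
    rw [cutPow, ← exp_neg, cutLog, e2, ← ofReal_log h2.le, h3, eps, ← exp_nat_mul, ← exp_nat_mul,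
      ← exp_add]
    congr 1
    push_cast
    ring
  rw [div_eq_mul_inv, h4, Real.sqrt_div hτ.le, show eps ^ 5 = (eps ^ 2) ^ 2 * eps by ring, eps_sq,
    eps_eq]
  push_cast
  field_simp
  rw [show (Real.sqrt 2 : ℂ) ^ 6 = ((Real.sqrt 2 : ℂ) ^ 2) ^ 3 by ring, hs2, I_sq]
  ring

/-! ### Convergent series in τ and in τ^{1/2}. -/

lemma IsSeriesIn.tendsto {p : ℝ → ℝ} {c₀ : ℂ} {u : ℝ → ℂ} (hu : IsSeriesIn p c₀ u)
    (hp : Tendsto p (𝓝[>] 0) (𝓝 0)) : Tendsto u (𝓝[>] 0) (𝓝 c₀) := by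
  obtain ⟨g, hg, rfl, hug⟩ := hu
  have h1 : Tendsto (fun τ => (p τ : ℂ)) (𝓝[>] 0) (𝓝 0) := by
    have := (continuous_ofReal.tendsto 0).comp hp
    rwa [ofReal_zero] at this
  exact (hg.continuousAt.tendsto.comp h1).congr' (hug.mono fun τ h => h.symm)

lemma analyticAt_saddleLog_saddleInv : AnalyticAt ℂ (fun t => saddleLog (saddleInv t)) 0 :=
  AnalyticAt.fun_comp (by rw [saddleInv_zero]; exact analyticAt_saddleLog) analyticAt_saddleInv

lemma isSeriesIn_A (m : ℕ) : IsSeriesIn (fun τ => τ) 1 (A (m + 2)) := by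
  refine ⟨fun t => exp (-saddleLog (saddleInv t) / 2) ^ (m + 3) + t ^ (m + 1) *
    (t ^ 2 + 4 * Real.pi * I) / Real.pi * (I / ((m + 2) * 2 ^ (m + 3)))
      * ((1 + saddleInv t) ^ (m + 2))⁻¹, ?_, ?_, ?_⟩
  · have h1 := analyticAt_saddleLog_saddleInv
    have h2 := analyticAt_saddleInv
    have h3 : AnalyticAt ℂ (fun t => ((1 + saddleInv t) ^ (m + 2))⁻¹) 0 :=
      AnalyticAt.inv (by fun_prop) (by simp [saddleInv_zero])
    simp only [div_eq_mul_inv]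
    fun_prop
  · simp [saddleInv_zero, saddleLog_zero]
  · filter_upwards [eventually_saddleData] with τ h using h.A_eq m

lemma isSeriesIn_B (n : ℕ) : IsSeriesIn (fun τ => τ) 1 (B (n + 1)) := by
  refine ⟨fun t => exp ((-5 / 2 - (n + 1 : ℕ)) * (saddleLog (saddleInv t) / 2)), ?_, ?_, ?_⟩
  · have h1 := analyticAt_saddleLog_saddleInv
    fun_prop
  · simp [saddleInv_zero, saddleLog_zero]
  · filter_upwards [eventually_saddleData] with τ h using h.B_eq n

lemma isSeriesIn_B_zero : IsSeriesIn Real.sqrt 1 (B 0) := by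
  refine ⟨fun t => -(1 + I) / 2 * t ^ 5
    + exp (-5 / 2 * (saddleLog (saddleInv (t ^ 2)) / 2)), ?_, ?_, ?_⟩
  · have h1 : AnalyticAt ℂ (fun t : ℂ => saddleLog (saddleInv (t ^ 2))) 0 :=
      AnalyticAt.fun_comp (g := fun t => saddleLog (saddleInv t)) (f := fun t => t ^ 2)
        (by simpa using analyticAt_saddleLog_saddleInv) (by fun_prop)
    fun_prop
  · simp [saddleInv_zero, saddleLog_zero]
  · filter_upwards [eventually_saddleData] with τ h
    rw [h.B_zero_eq, inv_cutPow_eq h.pos, ← ofReal_pow, ← ofReal_pow, Real.sq_sqrt h.pos.le]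

namespace IsSeriesIn

variable {p : ℝ → ℝ} {c c' : ℂ} {u v : ℝ → ℂ}

lemma const (p : ℝ → ℝ) (c : ℂ) : IsSeriesIn p c fun _ => c :=
  ⟨fun _ => c, analyticAt_const, rfl, Eventually.of_forall fun _ => rfl⟩

lemma add (hu : IsSeriesIn p c u) (hv : IsSeriesIn p c' v) :
    IsSeriesIn p (c + c') fun τ => u τ + v τ := by
  obtain ⟨g, hg, rfl, hug⟩ := hu
  obtain ⟨g', hg', rfl, hug'⟩ := hv
  exact ⟨fun t => g t + g' t, by fun_prop, rfl, by filter_upwards [hug, hug'] with τ h h' using (by rw [h, h'])⟩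

lemma mul (hu : IsSeriesIn p c u) (hv : IsSeriesIn p c' v) :
    IsSeriesIn p (c * c') fun τ => u τ * v τ := by
  obtain ⟨g, hg, rfl, hug⟩ := hu
  obtain ⟨g', hg', rfl, hug'⟩ := hv
  exact ⟨fun t => g t * g' t, by fun_prop, rfl, by filter_upwards [hug, hug'] with τ h h' using (by rw [h, h'])⟩

lemma inv (hu : IsSeriesIn p c u) (hc : c ≠ 0) : IsSeriesIn p c⁻¹ fun τ => (u τ)⁻¹ := by
  obtain ⟨g, hg, rfl, hug⟩ := hu
  exact ⟨fun t => (g t)⁻¹, hg.inv hc, rfl, by filter_upwards [hug] with τ h using by rw [h]⟩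

lemma pow (hu : IsSeriesIn p c u) (n : ℕ) : IsSeriesIn p (c ^ n) fun τ => u τ ^ n := by
  obtain ⟨g, hg, rfl, hug⟩ := hu
  exact ⟨fun t => g t ^ n, by fun_prop, rfl, by filter_upwards [hug] with τ h using by rw [h]⟩

lemma sqrt (hu : IsSeriesIn (fun τ => τ) c u) : IsSeriesIn Real.sqrt c u := by
  obtain ⟨g, hg, rfl, hug⟩ := hu
  refine ⟨fun t => g (t ^ 2), ?_, by simp, ?_⟩
  · exact AnalyticAt.fun_comp (g := g) (f := fun t => t ^ 2) (by simpa using hg) (by fun_prop)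
  · filter_upwards [hug, self_mem_nhdsWithin] with τ h hτ
    rw [h, ← ofReal_pow, Real.sq_sqrt (le_of_lt hτ)]

lemma exists_sum {ι : Type*} (S : Finset ι) {w : ι → ℝ → ℂ}
    (h : ∀ i ∈ S, ∃ c₀, IsSeriesIn p c₀ (w i)) :
    ∃ c₀, IsSeriesIn p c₀ fun τ => ∑ i ∈ S, w i τ := by
  classical
  induction S using Finset.induction_on with
  | empty => exact ⟨0, by simpa using const p 0⟩
  | insert i S hi ih =>
    obtain ⟨c₁, h₁⟩ := h i (Finset.mem_insert_self _ _)
    obtain ⟨c₂, h₂⟩ := ih fun j hj => h j (Finset.mem_insert_of_mem hj)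
    exact ⟨c₁ + c₂, by simpa [Finset.sum_insert hi] using h₁.add h₂⟩

end IsSeriesIn

lemma exists_isSeriesIn_coeff_ampSeries (n : ℕ) :
    ∃ c₀, IsSeriesIn Real.sqrt c₀ fun τ => PowerSeries.coeff n (ampSeries τ) := by
  have hB : IsSeriesIn Real.sqrt 1 (B n) := by
    cases n with
    | zero => exact isSeriesIn_B_zero
    | succ n => exact (isSeriesIn_B n).sqrt
  simp only [ampSeries, PowerSeries.coeff_mk]
  exact ⟨_, (hB.mul (.const _ _)).mul (.const _ _)⟩

lemma exists_isSeriesIn_coeff_expSeries (n : ℕ) :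
    ∃ c₀, IsSeriesIn Real.sqrt c₀ fun τ => PowerSeries.coeff n (expSeries τ) := by
  simp only [expSeries, PowerSeries.coeff_mk]
  split_ifs with h
  · exact ⟨_, .const _ _⟩
  · exact ⟨_, ((IsSeriesIn.const _ _).mul (isSeriesIn_A n).sqrt).mul (.const _ _)⟩

lemma exists_isSeriesIn_coeff_mul_pow (k n : ℕ) : ∃ c₀, IsSeriesIn Real.sqrt c₀
    fun τ => PowerSeries.coeff n (ampSeries τ * expSeries τ ^ k) := by
  induction k generalizing n with
  | zero => simpa using exists_isSeriesIn_coeff_ampSeries n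
  | succ k ih =>
    simp only [pow_succ, ← mul_assoc]
    simp only [PowerSeries.coeff_mul]
    simp only [PowerSeries.coeff_mul] at ih
    refine IsSeriesIn.exists_sum _ fun i _ => ?_
    obtain ⟨c₁, h₁⟩ := ih i.1
    obtain ⟨c₂, h₂⟩ := exists_isSeriesIn_coeff_expSeries i.2
    exact ⟨_, h₁.mul h₂⟩

/-- A finite algebraic expression in the A_j and B_j; the only divisions by functions of τ are by
powers of A_2 and by B_0, whose constant terms are 1. -/
lemma exists_isSeriesIn_F (n : ℕ) : ∃ c₀, IsSeriesIn Real.sqrt c₀ (F n) := by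
  have hpi : (Real.pi : ℂ) ≠ 0 := by exact_mod_cast Real.pi_ne_zero
  have hspi : (Real.sqrt Real.pi : ℂ) ≠ 0 := by
    exact_mod_cast (Real.sqrt_pos.2 Real.pi_pos).ne'
  have hsum := IsSeriesIn.exists_sum (p := Real.sqrt) (Finset.range (2 * n + 1))
    (w := fun k τ => (Real.Gamma (n + k + 1 / 2) : ℂ) * c (2 * n) k τ
      / (2 * Real.pi * A 2 τ) ^ (n + k)) (by
    intro k _
    obtain ⟨c₁, h₁⟩ := exists_isSeriesIn_coeff_mul_pow k (2 * n)
    simp only [c, div_eq_mul_inv]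
    exact ⟨_, ((IsSeriesIn.const _ _).mul (h₁.mul (.const _ _))).mul
      ((((IsSeriesIn.const _ _).mul (isSeriesIn_A 0).sqrt).pow _).inv (by simp [hpi]))⟩)
  obtain ⟨c₁, h₁⟩ := hsum
  refine ⟨_, h₁.mul (((IsSeriesIn.const _ _).mul isSeriesIn_B_zero).inv (by simpa using hspi))⟩

/-! ### First terms of E, A_2 and B_0. -/

lemma AnalyticAt.dslope_self {g : ℂ → ℂ} {a : ℂ} (hg : AnalyticAt ℂ g a) :
    AnalyticAt ℂ (dslope g a) a := by
  obtain ⟨p, hp⟩ := hg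
  exact ⟨_, hp.has_fpower_series_dslope_fslope⟩

/-- Division by the variable lowers the order of vanishing by one. -/
lemma isBigO_of_id_mul {u : ℂ → ℂ} {n : ℕ} (hu : ContinuousAt u 0)
    (h : (fun s => s * u s) =O[𝓝 0] fun s : ℂ => s ^ (n + 1)) :
    u =O[𝓝 0] fun s : ℂ => s ^ n := by
  obtain ⟨C, hC⟩ := h.bound
  have h1 : ∀ᶠ s in 𝓝[≠] (0 : ℂ), ‖u s‖ ≤ C * ‖s ^ n‖ := by
    filter_upwards [nhdsWithin_le_nhds hC, self_mem_nhdsWithin] with s hs h0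
    have h0 : 0 < ‖s‖ := norm_pos_iff.2 h0
    rw [norm_mul, pow_succ, norm_mul, ← mul_assoc, mul_comm] at hs
    exact le_of_mul_le_mul_right hs h0
  have h2 : ‖u 0‖ ≤ C * ‖(0 : ℂ) ^ n‖ := by
    have ha : Tendsto (fun s => ‖u s‖) (𝓝[≠] 0) (𝓝 ‖u 0‖) := hu.norm.mono_left nhdsWithin_le_nhds
    have hb : Tendsto (fun s : ℂ => C * ‖s ^ n‖) (𝓝[≠] 0) (𝓝 (C * ‖(0 : ℂ) ^ n‖)) := by
      have : Continuous fun s : ℂ => C * ‖s ^ n‖ := by fun_prop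
      exact (this.tendsto 0).mono_left nhdsWithin_le_nhds
    exact le_of_tendsto_of_tendsto ha hb h1
  refine IsBigO.of_bound C ?_
  rw [eventually_nhdsWithin_iff] at h1
  filter_upwards [h1] with s hs
  by_cases h0 : s = 0
  · rw [h0]; exact h2
  · exact hs h0

/-- `log (1 + s) / s`, extended by `1` to `s = 0`. -/
def logQuot : ℂ → ℂ := dslope (fun s => log (1 + s)) 0

lemma mul_logQuot (s : ℂ) : s * logQuot s = log (1 + s) := by
  have := sub_smul_dslope (fun s => log (1 + s)) 0 s
  simpa [logQuot] using this

lemma analyticAt_logQuot : AnalyticAt ℂ logQuot 0 :=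
  AnalyticAt.dslope_self (AnalyticAt.clog (by fun_prop) (by simp))

lemma hasJetFour_logQuot : HasJetFour logQuot 1 (-1 / 2) (1 / 3) (-1 / 4) := by
  -- One order more than the claim, since dividing by s costs one.
  have h : (fun s : ℂ => log (1 + s) - logTaylor 5 s) =O[𝓝 0] fun s : ℂ => s ^ 5 := by
    refine IsBigO.of_bound 1 ?_
    filter_upwards [Metric.ball_mem_nhds (0 : ℂ) (show (0 : ℝ) < 1 / 2 by norm_num)] with s hs
    have hs : ‖s‖ < 1 / 2 := by simpa using hs
    have h := norm_log_sub_logTaylor_le 4 (z := s) (by linarith)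
    refine h.trans ?_
    have h1 : (1 - ‖s‖)⁻¹ ≤ 2 := by
      rw [inv_le_comm₀ (by linarith) (by norm_num)]
      linarith
    have h2 : 0 ≤ ‖s‖ ^ 5 := by positivity
    norm_num
    nlinarith
  refine isBigO_of_id_mul ?_ (h.congr_left fun s => ?_)
  · have := analyticAt_logQuot.continuousAt
    fun_prop
  · rw [mul_sub, mul_logQuot]
    simp [logTaylor, Finset.sum_range_succ]
    ring

/-- The variable `s` times the logarithm of `E`. -/
def phaseNum (s : ℂ) : ℂ :=
  -(Real.pi * I) * s ^ 2 + Real.pi * I / 4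
    + (s ^ 2 / 4 + Real.pi * I / 4 * saddlePoly s) * logQuot s
    - Real.pi * I / 2 * exp (1 / 2 * saddleLog s) + Real.pi * I / 8 * s

/-- The logarithm of `E` as a function of the saddle. -/
def phaseQuot : ℂ → ℂ := dslope phaseNum 0

lemma analyticAt_phaseNum : AnalyticAt ℂ phaseNum 0 := by
  have h1 := analyticAt_logQuot
  have h2 := analyticAt_saddleLog
  have h3 := analyticAt_saddlePoly 0
  unfold phaseNum
  simp only [div_eq_mul_inv]
  fun_prop

lemma analyticAt_phaseQuot : AnalyticAt ℂ phaseQuot 0 := AnalyticAt.dslope_self analyticAt_phaseNum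

lemma hasJetFour_saddlePoly : HasJetFour saddlePoly 1 1 (4 + I / Real.pi) 4 := by
  refine (HasJetFour.poly 1 1 (4 + I / Real.pi) 4).congr (Eventually.of_forall fun s => ?_)
  rw [saddlePoly]
  ring

/-- The two vanishing coefficients are the point: the first removes the pole of log E at s = 0, the
second gives log E the value 0 there. They rest on the normalizing phases πi/τ and -πi/8. -/
lemma hasJetFour_phaseNum : HasJetFour phaseNum 0 0 (1 / 4 - 47 * I * Real.pi / 48)
    (-1 / 8 - I * Real.pi / 96) := by
  have hpi : (Real.pi : ℂ) ≠ 0 := by exact_mod_cast Real.pi_ne_zero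
  have h1 := (HasJetFour.poly (Real.pi * I / 4) (Real.pi * I / 8) (-(Real.pi * I)) 0).add
    ((((HasJetFour.poly 0 0 (1 / 4) 0).add (hasJetFour_saddlePoly.const_mul (Real.pi * I / 4))).mul
      hasJetFour_logQuot).add ((hasJetFour_exp_saddleLog (1 / 2)).const_mul (-(Real.pi * I / 2))))
  refine (h1.of_eq ?_ ?_ ?_ ?_).congr (Eventually.of_forall fun s => ?_)
  · ring
  · ring
  · field_simp
    ring
  · field_simp
    ring
  · rw [phaseNum]
    ring

lemma mul_phaseQuot (s : ℂ) : s * phaseQuot s = phaseNum s := by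
  have h0 : phaseNum 0 = 0 :=
    tendsto_nhds_unique (analyticAt_phaseNum.continuousAt.tendsto) hasJetFour_phaseNum.tendsto
  have := sub_smul_dslope phaseNum 0 s
  simpa [h0, phaseQuot] using this

lemma hasJetThree_phaseQuot : HasJetThree phaseQuot 0 (1 / 4 - 47 * I * Real.pi / 48)
    (-1 / 8 - I * Real.pi / 96) := by
  refine isBigO_of_id_mul ?_ (IsBigO.congr_left hasJetFour_phaseNum fun s => ?_)
  · have := analyticAt_phaseQuot.continuousAt
    fun_prop
  · rw [mul_sub, mul_phaseQuot]
    ring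

/-- Substituting 1/τ = exp(L/2)/(2s) and 1/τ² = P(s)/(4s²) makes log E a function of s alone, with
at most a simple pole; multiplying by s clears the denominator. -/
lemma SaddleData.E_eq {τ : ℝ} {s L : ℂ} (h : SaddleData τ s L) : E τ = exp (phaseQuot s) := by
  have hs := h.ne_zero
  have hτ := h.tau_ne_zero
  rw [E, ← exp_sub, h.q_eq]
  congr 1
  refine mul_left_cancel₀ hs ?_
  have h1 : 1 / (τ : ℂ) = exp (1 / 2 * L) / (2 * s) := by
    rw [h.param, div_eq_div_iff (by simp [hs]) (by simp [hs])]
    have : exp (-L / 2) * exp (1 / 2 * L) = 1 := by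
      rw [← exp_add]
      ring_nf
      exact exp_zero
    linear_combination (-2 * s) * this
  have h2 : 1 / (τ : ℂ) ^ 2 = saddlePoly s / (4 * s ^ 2) := by
    have : exp (1 / 2 * L) ^ 2 = saddlePoly s := by
      rw [← h.exp_eq, ← exp_nat_mul]
      congr 1
      push_cast
      ring
    rw [← one_div_pow, h1, div_pow, this]
    ring
  rw [mul_phaseQuot, phaseNum, phase, ← h.log_eq, h1,
    show 1 - I * (I * s) = 1 + s by linear_combination -s * I_sq, ← mul_logQuot,
    show 2 * Real.pi * I / (τ : ℂ) ^ 2 = 2 * Real.pi * I * (1 / (τ : ℂ) ^ 2) by ring, h2]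
  have hI : (4 * (I * s))⁻¹ = -I / (4 * s) := by
    rw [mul_inv, mul_inv, inv_I]
    field_simp
  rw [div_eq_mul_inv (Real.pi : ℂ), hI]
  field_simp
  ring

lemma isSeriesIn_E : IsSeriesIn (fun τ => τ) 1 E := by
  refine ⟨fun t => exp (phaseQuot (saddleInv t)), ?_, ?_, ?_⟩
  · have : AnalyticAt ℂ (fun t => phaseQuot (saddleInv t)) 0 :=
      AnalyticAt.fun_comp (by rw [saddleInv_zero]; exact analyticAt_phaseQuot) analyticAt_saddleInv
    fun_prop
  · have : phaseQuot 0 = 0 :=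
      tendsto_nhds_unique (analyticAt_phaseQuot.continuousAt.tendsto) hasJetThree_phaseQuot.tendsto
    simp [saddleInv_zero, this]
  · filter_upwards [eventually_saddleData] with τ h using h.E_eq

lemma hasJetThree_saddleParam : HasJetThree saddleParam 0 2 (-1) := by
  have h := (HasJetThree.poly 0 2 0).mul (hasJetFour_exp_saddleLog (-1 / 2)).jetThree
  refine (h.of_eq (by ring) (by ring) (by ring)).congr (Eventually.of_forall fun s => ?_)
  rw [saddleParam]
  ring_nf

lemma isBigO_saddleInv : (fun τ : ℝ => saddleInv τ) =O[𝓝[>] 0] fun τ : ℝ => τ := by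
  refine IsBigO.of_bound 1 ?_
  filter_upwards [eventually_saddleData] with τ h
  have h1 := norm_le_norm_add_norm_sub' (saddleInv τ) (τ / 2 : ℂ)
  rw [norm_ofReal_div_two h.pos] at h1
  have h2 := h.near
  rw [Real.norm_eq_abs, abs_of_pos h.pos]
  linarith [h.pos]

/-- An expansion in the variable `s` becomes one in `τ`. -/
lemma HasJetThree.isBigO_ofReal {u : ℂ → ℂ} {c₀ c₁ c₂ : ℂ} {U : ℝ → ℂ}
    (hu : HasJetThree u c₀ (2 * c₁) (4 * c₂ - c₁))
    (hU : ∀ᶠ τ : ℝ in 𝓝[>] 0, U τ = u (saddleInv τ)) :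
    (fun τ : ℝ => U τ - (c₀ + c₁ * τ + c₂ * (τ : ℂ) ^ 2)) =O[𝓝[>] 0] fun τ : ℝ => τ ^ 3 := by
  -- As τ = 2s - s² + O(s³), the polynomial c₀ + c₁τ + c₂τ² has coefficients c₀, 2c₁ and 4c₂ - c₁ in
  -- s.
  have h1 := hasJetThree_saddleParam.comp (HasJetThree.poly c₀ c₁ c₂)
  have h2 : (fun s => u s - (c₀ + c₁ * saddleParam s + c₂ * saddleParam s ^ 2)) =O[𝓝 0]
      fun s : ℂ => s ^ 3 := (IsBigO.sub hu h1).congr_left fun s => by ring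
  have h3 := (h2.comp_tendsto tendsto_saddleInv).trans (isBigO_saddleInv.pow 3)
  refine h3.congr' ?_ EventuallyEq.rfl
  filter_upwards [hU, tendsto_ofReal_nhdsGT.eventually saddleParam_saddleInv] with τ h4 h5
  simp only [Function.comp, h4, h5]

lemma E_expansion :
    (fun τ : ℝ => E τ - (1 + (1 / 8 - 47 * I * Real.pi / 96) * τ
      + (144 - 3432 * I * Real.pi - 2209 * (Real.pi : ℂ) ^ 2) / 18432 * (τ : ℂ) ^ 2))
      =O[𝓝[>] (0 : ℝ)] fun τ : ℝ => τ ^ 3 := by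
  refine HasJetThree.isBigO_ofReal (u := fun s => exp (phaseQuot s)) ?_
    (eventually_saddleData.mono fun τ h => h.E_eq)
  refine (hasJetThree_phaseQuot.comp HasJetFour.exp.jetThree).of_eq rfl (by ring) ?_
  ring_nf
  simp only [I_sq]
  ring

lemma hasJetThree_inv_one_add : HasJetThree (fun s => (1 + s)⁻¹) 1 (-1) 1 := by
  have h : (fun s : ℂ => s ^ 3 * -(1 + s)⁻¹) =O[𝓝 0] fun s : ℂ => s ^ 3 := by
    refine isBigO_self_mul (ContinuousAt.neg (ContinuousAt.inv₀ (by fun_prop) (by simp)))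
  refine h.congr' ?_ EventuallyEq.rfl
  have h1 : ∀ᶠ s in 𝓝 (0 : ℂ), 1 + s ≠ 0 :=
    ContinuousAt.eventually_ne (by fun_prop) (by simp)
  filter_upwards [h1] with s hs
  field_simp
  ring

lemma A_two_expansion :
    (fun τ : ℝ => A 2 τ - (1 - τ + (-31 / 32 - 3 * I / (8 * Real.pi)) * (τ : ℂ) ^ 2))
      =O[𝓝[>] (0 : ℝ)] fun τ : ℝ => τ ^ 3 := by
  have hpi : (Real.pi : ℂ) ≠ 0 := by exact_mod_cast Real.pi_ne_zero
  have h1 := hasJetThree_saddleParam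
  have h2 := (hasJetFour_exp_saddleLog (-3 / 2)).jetThree
  -- For m = 0 the logarithmic part of `SaddleData.A_eq` is τ(iτ²/(16π) - 1/4)(1+s)^{-2}.
  have h3 := h2.add ((h1.mul (((h1.mul h1).const_mul (I / (16 * Real.pi))).add
    (HasJetThree.poly (-1 / 4) 0 0))).mul (hasJetThree_inv_one_add.mul hasJetThree_inv_one_add))
  have h4 := HasJetThree.isBigO_ofReal (U := A 2) (c₀ := 1) (c₁ := -1)
    (c₂ := -31 / 32 - 3 * I / (8 * Real.pi)) (h3.of_eq ?_ ?_ ?_) ?_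
  · exact h4.congr_left fun τ => by ring
  · ring
  · ring
  · field_simp
    ring
  · filter_upwards [eventually_saddleData, tendsto_ofReal_nhdsGT.eventually saddleParam_saddleInv]
      with τ h h5
    rw [h.A_eq 0, h5, ← exp_nat_mul]
    rw [show ((0 + 3 : ℕ) : ℂ) * (-saddleLog (saddleInv τ) / 2)
      = -3 / 2 * saddleLog (saddleInv τ) by push_cast; ring]
    congr 1
    rw [show ((1 + saddleInv τ) ^ (0 + 2))⁻¹ = (1 + saddleInv τ)⁻¹ * (1 + saddleInv τ)⁻¹ by
      rw [pow_two, mul_inv]]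
    push_cast
    field_simp
    ring_nf
    simp only [I_sq]
    ring

lemma B_zero_expansion :
    (fun τ : ℝ => B 0 τ - (1 - 5 / 8 * τ
        - 5 * (27 * Real.pi + 8 * I) / (128 * Real.pi) * (τ : ℂ) ^ 2
        - (1 / 2 + I / 2) * ((τ ^ (5 / 2 : ℝ) : ℝ) : ℂ)))
      =O[𝓝[>] (0 : ℝ)] fun τ : ℝ => τ ^ 3 := by
  have hpi : (Real.pi : ℂ) ≠ 0 := by exact_mod_cast Real.pi_ne_zero
  have h4 := HasJetThree.isBigO_ofReal
    (U := fun τ => B 0 τ + (1 / 2 + I / 2) * ((τ ^ (5 / 2 : ℝ) : ℝ) : ℂ)) (c₀ := 1) (c₁ := -5 / 8)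
    (c₂ := -5 * (27 * Real.pi + 8 * I) / (128 * Real.pi))
    ((hasJetFour_exp_saddleLog (-5 / 4)).jetThree.of_eq rfl ?_ ?_) ?_
  · exact h4.congr_left fun τ => by ring
  · ring
  · field_simp
    ring
  · filter_upwards [eventually_saddleData] with τ h
    have h6 : τ ^ (5 / 2 : ℝ) = Real.sqrt τ ^ 5 := by
      rw [Real.sqrt_eq_rpow, ← Real.rpow_mul_natCast h.pos.le]
      norm_num
    rw [h.B_zero_eq, inv_cutPow_eq h.pos, h6]
    push_cast
    rw [show -5 / 2 * (saddleLog (saddleInv τ) / 2) = -5 / 4 * saddleLog (saddleInv τ) by ring]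
    ring

/-! ### The explicit F_0, F_1 and F_2. -/

/-- The coefficients of a product whose second factor has no constant term. -/
lemma coeff_mul_of_coeff_zero (p q : PowerSeries ℂ) (hq : PowerSeries.coeff 0 q = 0) :
    (PowerSeries.coeff 0 (p * q) = 0) ∧
    (PowerSeries.coeff 1 (p * q) = PowerSeries.coeff 0 p * PowerSeries.coeff 1 q) ∧
    (PowerSeries.coeff 2 (p * q) = PowerSeries.coeff 1 p * PowerSeries.coeff 1 q
      + PowerSeries.coeff 0 p * PowerSeries.coeff 2 q) ∧
    (PowerSeries.coeff 3 (p * q) = PowerSeries.coeff 2 p * PowerSeries.coeff 1 q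
      + PowerSeries.coeff 1 p * PowerSeries.coeff 2 q
      + PowerSeries.coeff 0 p * PowerSeries.coeff 3 q) ∧
    PowerSeries.coeff 4 (p * q) = PowerSeries.coeff 3 p * PowerSeries.coeff 1 q
      + PowerSeries.coeff 2 p * PowerSeries.coeff 2 q
      + PowerSeries.coeff 1 p * PowerSeries.coeff 3 q
      + PowerSeries.coeff 0 p * PowerSeries.coeff 4 q := by
  simp only [PowerSeries.coeff_mul, Finset.Nat.antidiagonal_succ, Finset.Nat.antidiagonal_zero,
    Finset.sum_cons, Finset.map_cons, Finset.map_singleton, Finset.sum_singleton,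
    Function.Embedding.prodMap, Function.Embedding.coeFn_mk, Prod.map, Nat.succ_eq_add_one,
    Function.Embedding.refl_apply, hq, Nat.reduceAdd, zero_add]
  refine ⟨?_, ?_, ?_, ?_, ?_⟩ <;> ring

lemma gamma_values : Real.Gamma (1 / 2) = Real.sqrt Real.pi ∧
    Real.Gamma (3 / 2) = 1 / 2 * Real.sqrt Real.pi ∧
    Real.Gamma (5 / 2) = 3 / 4 * Real.sqrt Real.pi ∧
    Real.Gamma (7 / 2) = 15 / 8 * Real.sqrt Real.pi ∧
    Real.Gamma (9 / 2) = 105 / 16 * Real.sqrt Real.pi ∧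
    Real.Gamma (11 / 2) = 945 / 32 * Real.sqrt Real.pi ∧
    Real.Gamma (13 / 2) = 10395 / 64 * Real.sqrt Real.pi := by
  have step : ∀ x y z : ℝ, 0 < x → y = x + 1 → Real.Gamma x = z → Real.Gamma y = x * z := by
    intro x y z hx hy h
    rw [hy, Real.Gamma_add_one hx.ne', h]
  have h0 := Real.Gamma_one_half_eq
  have h1 := step _ (3 / 2) _ (by norm_num) (by norm_num) h0
  have h2 := step _ (5 / 2) _ (by norm_num) (by norm_num) h1
  have h3 := step _ (7 / 2) _ (by norm_num) (by norm_num) h2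
  have h4 := step _ (9 / 2) _ (by norm_num) (by norm_num) h3
  have h5 := step _ (11 / 2) _ (by norm_num) (by norm_num) h4
  have h6 := step _ (13 / 2) _ (by norm_num) (by norm_num) h5
  refine ⟨h0, h1, h2.trans ?_, h3.trans ?_, h4.trans ?_, h5.trans ?_, h6.trans ?_⟩ <;> ring

lemma choose_values : Ring.choose (-5 / 2 : ℂ) 0 = 1 ∧ Ring.choose (-5 / 2 : ℂ) 1 = -5 / 2 ∧
    Ring.choose (-5 / 2 : ℂ) 2 = 35 / 8 ∧ Ring.choose (-5 / 2 : ℂ) 3 = -105 / 16 ∧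
    Ring.choose (-5 / 2 : ℂ) 4 = 1155 / 128 := by
  have h1 := succ_mul_choose_succ (-5 / 2) 1
  have h2 := succ_mul_choose_succ (-5 / 2) 2
  have h3 := succ_mul_choose_succ (-5 / 2) 3
  have h0 : Ring.choose (-5 / 2 : ℂ) 1 = -5 / 2 := Ring.choose_one_right _
  norm_num [h0] at h1
  have e2 : Ring.choose (-(5 / 2) : ℂ) 2 = 35 / 8 := by linear_combination 1 / 2 * h1
  norm_num [e2] at h2
  have e3 : Ring.choose (-(5 / 2) : ℂ) 3 = -105 / 16 := by linear_combination 1 / 3 * h2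
  norm_num [e3] at h3
  have e4 : Ring.choose (-(5 / 2) : ℂ) 4 = 1155 / 128 := by linear_combination 1 / 4 * h3
  refine ⟨by simp, h0, ?_, ?_, ?_⟩
  · rw [neg_div, e2]
  · rw [neg_div, e3]
  · rw [neg_div, e4]

lemma two_div_eps_cubed : 2 / eps ^ 3 = -2 * eps := by
  have h0 : eps ≠ 0 := exp_ne_zero _
  rw [div_eq_iff (pow_ne_zero _ h0), show -2 * eps * eps ^ 3 = -2 * (eps ^ 2) ^ 2 by ring, eps_sq,
    I_sq]
  ring

lemma coeff_expSeries_zero (τ : ℝ) : PowerSeries.coeff 0 (expSeries τ) = 0 := by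
  simp [expSeries]

lemma coeff_expSeries_succ (τ : ℝ) (m : ℕ) : PowerSeries.coeff (m + 1) (expSeries τ)
    = Real.pi * I / 2 * A (m + 3) τ * (-2 * eps) ^ (m + 3) := by
  simp [expSeries, two_div_eps_cubed]

lemma coeff_ampSeries (τ : ℝ) (n : ℕ) : PowerSeries.coeff n (ampSeries τ)
    = B n τ * Ring.choose (-5 / 2 : ℂ) n * (2 * eps) ^ n := by
  simp [ampSeries]

lemma F_zero_eq {τ : ℝ} (hB : B 0 τ ≠ 0) : F 0 τ = 1 := by
  have hspi : (Real.sqrt Real.pi : ℂ) ≠ 0 := by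
    exact_mod_cast (Real.sqrt_pos.2 Real.pi_pos).ne'
  have h : PowerSeries.coeff 0 (ampSeries τ) = B 0 τ := by simp [coeff_ampSeries]
  simp only [F, c, Finset.sum_range_succ, Finset.sum_range_zero, mul_zero, zero_add, pow_zero,
    mul_one, h, Nat.factorial, Nat.cast_zero, Nat.cast_one, div_one, gamma_values.1]
  field_simp

lemma eps_pow_four : eps ^ 4 = -1 := by
  rw [show eps ^ 4 = (eps ^ 2) ^ 2 by ring, eps_sq, I_sq]

/-- Each exponent factor contributes two more powers of ε than of x, so every term of c_{2n,k}
carries ε^{2n+2k} = i^{n+k}. Thus ε disappears and only powers of i remain; the same holds for F_2.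
-/
lemma F_one_eq {τ : ℝ} (hA : A 2 τ ≠ 0) (hB : B 0 τ ≠ 0) :
    F 1 τ = -(15 * I * A 3 τ * B 1 τ) / (4 * Real.pi * A 2 τ ^ 2 * B 0 τ)
        + 35 * I * B 2 τ / (8 * Real.pi * A 2 τ * B 0 τ)
        + 15 * I * A 3 τ ^ 2 / (8 * Real.pi * A 2 τ ^ 3)
        - 3 * I * A 4 τ / (2 * Real.pi * A 2 τ ^ 2) := by
  have hspi : (Real.sqrt Real.pi : ℂ) ≠ 0 := by
    exact_mod_cast (Real.sqrt_pos.2 Real.pi_pos).ne'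
  have hpi : (Real.pi : ℂ) ≠ 0 := by exact_mod_cast Real.pi_ne_zero
  have he := coeff_expSeries_zero τ
  have e1 := coeff_expSeries_succ τ 0
  have e2 := coeff_expSeries_succ τ 1
  obtain ⟨g0, g1, g2, g3, g4, g5, g6⟩ := gamma_values
  obtain ⟨b0, b1, b2, b3, b4⟩ := choose_values
  obtain ⟨c0, c1, c2, c3, c4⟩ := coeff_mul_of_coeff_zero (ampSeries τ) (expSeries τ) he
  obtain ⟨d0, d1, d2, d3, d4⟩ := coeff_mul_of_coeff_zero (ampSeries τ * expSeries τ) _ he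
  norm_num at e1 e2
  simp only [F, c, Finset.sum_range_succ, Finset.sum_range_zero, mul_one, Nat.reduceAdd, pow_zero,
    pow_one, pow_two (expSeries τ), ← mul_assoc, c0, c1, c2, d2, e1, e2, coeff_ampSeries,
    b0, b1, b2]
  norm_num [Nat.factorial, g1, g2, g3]
  field_simp
  rw [eps_sq, eps_pow_four]
  linear_combination (48 * I * A 2 τ * (5 * B 1 τ * A 3 τ + 2 * B 0 τ * A 4 τ)
    - 120 * I * A 3 τ ^ 2 * B 0 τ) * I_sq

set_option maxHeartbeats 1000000 in
lemma F_two_eq {τ : ℝ} (hA : A 2 τ ≠ 0) (hB : B 0 τ ≠ 0) :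
    F 2 τ = 1575 * A 3 τ ^ 3 * B 1 τ / (32 * (Real.pi : ℂ) ^ 2 * A 2 τ ^ 5 * B 0 τ)
        - 3675 * A 3 τ ^ 2 * B 2 τ / (64 * (Real.pi : ℂ) ^ 2 * A 2 τ ^ 4 * B 0 τ)
        - 525 * A 4 τ * A 3 τ * B 1 τ / (8 * (Real.pi : ℂ) ^ 2 * A 2 τ ^ 4 * B 0 τ)
        + 1575 * A 3 τ * B 3 τ / (32 * (Real.pi : ℂ) ^ 2 * A 2 τ ^ 3 * B 0 τ)
        + 75 * A 5 τ * B 1 τ / (4 * (Real.pi : ℂ) ^ 2 * A 2 τ ^ 3 * B 0 τ)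
        + 525 * A 4 τ * B 2 τ / (16 * (Real.pi : ℂ) ^ 2 * A 2 τ ^ 3 * B 0 τ)
        - 3465 * B 4 τ / (128 * (Real.pi : ℂ) ^ 2 * A 2 τ ^ 2 * B 0 τ)
        - 3465 * A 3 τ ^ 4 / (128 * (Real.pi : ℂ) ^ 2 * A 2 τ ^ 6)
        + 945 * A 4 τ * A 3 τ ^ 2 / (16 * (Real.pi : ℂ) ^ 2 * A 2 τ ^ 5)
        - 105 * A 5 τ * A 3 τ / (4 * (Real.pi : ℂ) ^ 2 * A 2 τ ^ 4)
        - 105 * A 4 τ ^ 2 / (8 * (Real.pi : ℂ) ^ 2 * A 2 τ ^ 4)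
        + 15 * A 6 τ / (2 * (Real.pi : ℂ) ^ 2 * A 2 τ ^ 3) := by
  have hspi : (Real.sqrt Real.pi : ℂ) ≠ 0 := by
    exact_mod_cast (Real.sqrt_pos.2 Real.pi_pos).ne'
  have hpi : (Real.pi : ℂ) ≠ 0 := by exact_mod_cast Real.pi_ne_zero
  have he := coeff_expSeries_zero τ
  have e1 := coeff_expSeries_succ τ 0
  have e2 := coeff_expSeries_succ τ 1
  have e3 := coeff_expSeries_succ τ 2
  have e4 := coeff_expSeries_succ τ 3
  obtain ⟨g0, g1, g2, g3, g4, g5, g6⟩ := gamma_values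
  obtain ⟨b0, b1, b2, b3, b4⟩ := choose_values
  obtain ⟨c0, c1, c2, c3, c4⟩ := coeff_mul_of_coeff_zero (ampSeries τ) (expSeries τ) he
  obtain ⟨d0, d1, d2, d3, d4⟩ := coeff_mul_of_coeff_zero (ampSeries τ * expSeries τ) _ he
  obtain ⟨p0, p1, p2, p3, p4⟩ :=
    coeff_mul_of_coeff_zero (ampSeries τ * expSeries τ * expSeries τ) _ he
  obtain ⟨-, -, -, -, q4⟩ :=
    coeff_mul_of_coeff_zero (ampSeries τ * expSeries τ * expSeries τ * expSeries τ) _ he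
  norm_num at e1 e2 e3 e4
  have hp3 : expSeries τ ^ 3 = expSeries τ * expSeries τ * expSeries τ := by ring
  have hp4 : expSeries τ ^ 4 = expSeries τ * expSeries τ * expSeries τ * expSeries τ := by ring
  simp only [F, c, Finset.sum_range_succ, Finset.sum_range_zero, mul_one, Nat.reduceAdd, pow_zero,
    Nat.reduceMul, pow_one, pow_two (expSeries τ), hp3, hp4, ← mul_assoc, c0, c1, c2, c3, c4, d0,
    d1, d2, d3, d4, p0, p1, p2, p3, p4, q4, e1, e2, e3, e4, coeff_ampSeries,
    b0, b1, b2, b3, b4]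
  norm_num [Nat.factorial, g2, g3, g4, g5, g6]
  have h6 : eps ^ 6 = -I := by rw [show eps ^ 6 = (eps ^ 2) ^ 3 by ring, eps_sq, I_pow_three]
  have h8 : eps ^ 8 = 1 := by rw [show eps ^ 8 = (eps ^ 4) ^ 2 by ring, eps_pow_four]; ring
  field_simp
  simp only [eps_sq, eps_pow_four, h6, h8, I_sq, I_pow_three, I_pow_four]
  ring_nf
  simp only [I_sq]
  ring

lemma eventually_A_two_ne_zero_and_B_zero_ne_zero : ∀ᶠ τ in 𝓝[>] (0 : ℝ), A 2 τ ≠ 0 ∧ B 0 τ ≠ 0 := by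
  have h1 : Tendsto (fun τ : ℝ => τ) (𝓝[>] 0) (𝓝 0) := tendsto_id.mono_left nhdsWithin_le_nhds
  have h2 : Tendsto Real.sqrt (𝓝[>] 0) (𝓝 0) := by
    simpa using (Real.continuous_sqrt.tendsto 0).mono_left nhdsWithin_le_nhds
  exact (((isSeriesIn_A 0).tendsto h1).eventually_ne one_ne_zero).and
    ((isSeriesIn_B_zero.tendsto h2).eventually_ne one_ne_zero)

/-! ### Power series with a weighted ℓ¹ bound. -/

/-- The power series converges absolutely on the disc of radius `1/4`, with majorant at most `K`. -/
def WBound (p : PowerSeries ℂ) (K : ℝ) : Prop :=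
  Summable (fun n => ‖PowerSeries.coeff n p‖ * (1 / 4) ^ n) ∧
    ∑' n, ‖PowerSeries.coeff n p‖ * (1 / 4) ^ n ≤ K

/-- The sum of a power series. -/
def evalSeries (p : PowerSeries ℂ) (x : ℝ) : ℂ := ∑' n, PowerSeries.coeff n p * (x : ℂ) ^ n

namespace WBound

variable {p q : PowerSeries ℂ} {K K' : ℝ}

lemma nonneg (hp : WBound p K) : 0 ≤ K :=
  (tsum_nonneg fun n => by positivity).trans hp.2

lemma norm_coeff_le (hp : WBound p K) (n : ℕ) : ‖PowerSeries.coeff n p‖ ≤ K * 4 ^ n := by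
  have h := (hp.1.le_tsum n fun m _ => by positivity).trans hp.2
  rwa [one_div, inv_pow, ← div_eq_mul_inv, div_le_iff₀ (by positivity)] at h

/-- The weighted ℓ¹ norm is submultiplicative, by the Cauchy product. -/
lemma mul (hp : WBound p K) (hq : WBound q K') : WBound (p * q) (K * K') := by
  have hp1 : Summable fun n => ‖‖PowerSeries.coeff n p‖ * (1 / 4) ^ n‖ := hp.1.norm
  have hq1 : Summable fun n => ‖‖PowerSeries.coeff n q‖ * (1 / 4) ^ n‖ := hq.1.norm
  have hle : ∀ n, ‖PowerSeries.coeff n (p * q)‖ * (1 / 4) ^ n ≤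
      ∑ kl ∈ Finset.HasAntidiagonal.antidiagonal n, (‖PowerSeries.coeff kl.1 p‖ * (1 / 4) ^ kl.1)
        * (‖PowerSeries.coeff kl.2 q‖ * (1 / 4) ^ kl.2) := by
    intro n
    rw [PowerSeries.coeff_mul]
    refine (mul_le_mul_of_nonneg_right (norm_sum_le _ _) (by positivity)).trans ?_
    rw [Finset.sum_mul]
    refine Finset.sum_le_sum fun kl hkl => le_of_eq ?_
    rw [← Finset.HasAntidiagonal.mem_antidiagonal.1 hkl, norm_mul, pow_add]
    ring
  have hs := (summable_norm_sum_mul_antidiagonal_of_summable_norm hp1 hq1).of_norm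
  have hsum : Summable fun n => ‖PowerSeries.coeff n (p * q)‖ * (1 / 4) ^ n :=
    Summable.of_nonneg_of_le (fun n => by positivity) hle hs
  refine ⟨hsum, (hsum.tsum_le_tsum hle hs).trans ?_⟩
  rw [← tsum_mul_tsum_eq_tsum_sum_antidiagonal_of_summable_norm hp1 hq1]
  exact mul_le_mul hp.2 hq.2 (tsum_nonneg fun n => by positivity) hp.nonneg

lemma mul_pow (hp : WBound p K) (hq : WBound q K') (k : ℕ) : WBound (p * q ^ k) (K * K' ^ k) := by
  induction k with
  | zero => simpa using hp
  | succ k ih => simpa [pow_succ, mul_assoc] using ih.mul hq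

lemma summable_norm (hp : WBound p K) {x : ℝ} (hx : |x| ≤ 1 / 4) :
    Summable fun n => ‖PowerSeries.coeff n p * (x : ℂ) ^ n‖ := by
  refine Summable.of_nonneg_of_le (fun n => by positivity) (fun n => ?_) hp.1
  rw [norm_mul, norm_pow, norm_real, Real.norm_eq_abs]
  gcongr

lemma evalSeries_mul (hp : WBound p K) (hq : WBound q K') {x : ℝ} (hx : |x| ≤ 1 / 4) :
    evalSeries (p * q) x = evalSeries p x * evalSeries q x := by
  rw [evalSeries, evalSeries, evalSeries, tsum_mul_tsum_eq_tsum_sum_antidiagonal_of_summable_norm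
    (hp.summable_norm hx) (hq.summable_norm hx)]
  refine tsum_congr fun n => ?_
  rw [PowerSeries.coeff_mul, Finset.sum_mul]
  refine Finset.sum_congr rfl fun kl hkl => ?_
  rw [← Finset.HasAntidiagonal.mem_antidiagonal.1 hkl, pow_add]
  ring

lemma evalSeries_mul_pow (hp : WBound p K) (hq : WBound q K') {x : ℝ} (hx : |x| ≤ 1 / 4) (k : ℕ) :
    evalSeries (p * q ^ k) x = evalSeries p x * evalSeries q x ^ k := by
  induction k with
  | zero => simp
  | succ k ih => rw [pow_succ, ← mul_assoc, (hp.mul_pow hq k).evalSeries_mul hq hx, ih, pow_succ,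
      mul_assoc]

/-- For n ≥ M and |x| ≤ 1/4 one has |x|^n ≤ (4|x|)^M (1/4)^n, so the tail is (4|x|)^M times a tail
of the majorant. -/
lemma norm_evalSeries_sub_le (hp : WBound p K) {x : ℝ} (hx : |x| ≤ 1 / 4) (M : ℕ) :
    ‖evalSeries p x - ∑ n ∈ Finset.range M, PowerSeries.coeff n p * (x : ℂ) ^ n‖
      ≤ K * (4 * |x|) ^ M := by
  have hs := hp.summable_norm hx
  rw [evalSeries, ← hs.of_norm.sum_add_tsum_nat_add M, add_sub_cancel_left]
  have hs' := (summable_nat_add_iff M).2 hs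
  have hp' := (summable_nat_add_iff M).2 hp.1
  refine (norm_tsum_le_tsum_norm hs').trans ?_
  have hle : ∀ n, ‖PowerSeries.coeff (n + M) p * (x : ℂ) ^ (n + M)‖ ≤
      (4 * |x|) ^ M * (‖PowerSeries.coeff (n + M) p‖ * (1 / 4) ^ (n + M)) := by
    intro n
    rw [norm_mul, norm_pow, norm_real, Real.norm_eq_abs, pow_add |x|, pow_add (1 / 4 : ℝ)]
    have h1 : |x| ^ n ≤ (1 / 4) ^ n := by gcongr
    have h2 : (4 * |x|) ^ M * (‖PowerSeries.coeff (n + M) p‖ * ((1 / 4) ^ n * (1 / 4) ^ M))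
        = ‖PowerSeries.coeff (n + M) p‖ * ((1 / 4) ^ n * |x| ^ M) := by
      have : (4 : ℝ) ^ M * (1 / 4) ^ M = 1 := by rw [← _root_.mul_pow]; norm_num
      rw [_root_.mul_pow]
      linear_combination (|x| ^ M * ‖PowerSeries.coeff (n + M) p‖ * (1 / 4) ^ n) * this
    rw [h2]
    gcongr
  refine (hs'.tsum_le_tsum hle (hp'.mul_left _)).trans ?_
  rw [tsum_mul_left, mul_comm]
  refine mul_le_mul_of_nonneg_right (le_trans ?_ hp.2) (by positivity)
  have h3 := hp.1.sum_add_tsum_nat_add M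
  have h4 : 0 ≤ ∑ n ∈ Finset.range M, ‖PowerSeries.coeff n p‖ * (1 / 4) ^ n :=
    Finset.sum_nonneg fun n _ => by positivity
  linarith

lemma norm_evalSeries_le (hp : WBound p K) {x : ℝ} (hx : |x| ≤ 1 / 4) : ‖evalSeries p x‖ ≤ K := by
  simpa using hp.norm_evalSeries_sub_le hx 0

end WBound

/-! ### The exponential remainder and Gaussian moments. -/

/-- The Taylor remainder of the exponential, bounded through the real part. -/
lemma norm_exp_sub_sum_le_max (M : ℕ) (z : ℂ) :
    ‖exp z - ∑ k ∈ Finset.range M, z ^ k / (k.factorial : ℂ)‖ ≤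
      ‖z‖ ^ M * max 1 (Real.exp z.re) := by
  induction M generalizing z with
  | zero => simp [norm_exp]
  | succ M ih =>
    -- Along the segment t ↦ tz the remainder of order M + 1 has derivative z times the remainder of
    -- order M, so the mean value inequality gives the induction step.
    set R : ℝ → ℂ := fun t => exp (t * z) - ∑ k ∈ Finset.range (M + 1),
      ((t : ℂ) * z) ^ k / (k.factorial : ℂ) with hR
    have hd : ∀ t : ℝ, HasDerivAt R (z * (exp (t * z) - ∑ k ∈ Finset.range M,
        ((t : ℂ) * z) ^ k / (k.factorial : ℂ))) t := by
      intro t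
      have hg : HasDerivAt (fun w : ℂ => exp w - ∑ k ∈ Finset.range (M + 1),
          w ^ k / (k.factorial : ℂ)) (exp (t * z) - ∑ k ∈ Finset.range M,
          ((t : ℂ) * z) ^ k / (k.factorial : ℂ)) (t * z) := by
        have h1 : HasDerivAt (fun w : ℂ => ∑ k ∈ Finset.range (M + 1), w ^ k / (k.factorial : ℂ))
            (∑ k ∈ Finset.range (M + 1), ((k : ℂ) * ((t : ℂ) * z) ^ (k - 1) / (k.factorial : ℂ)))
            (t * z) := by
          refine HasDerivAt.fun_sum fun k _ => ?_
          exact (hasDerivAt_pow k _).div_const _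
        refine ((hasDerivAt_exp _).sub h1).congr_deriv ?_
        rw [Finset.sum_range_succ']
        congr 1
        simp only [Nat.cast_zero, zero_mul, zero_div, add_zero, Nat.add_sub_cancel]
        refine Finset.sum_congr rfl fun k _ => ?_
        rw [Nat.factorial_succ]
        have h2 : (k.factorial : ℂ) ≠ 0 := by exact_mod_cast k.factorial_ne_zero
        have h3 : ((k : ℂ) + 1) ≠ 0 := by norm_cast
        push_cast
        field_simp
      have hl : HasDerivAt (fun t : ℝ => (t : ℂ) * z) z t := by
        simpa using (hasDerivAt_id t).ofReal_comp.mul_const z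
      have := hg.comp t hl
      rw [mul_comm z]
      exact this
    have hbound : ∀ t ∈ Set.Ico (0 : ℝ) 1, ‖z * (exp (t * z) - ∑ k ∈ Finset.range M,
        ((t : ℂ) * z) ^ k / (k.factorial : ℂ))‖ ≤ ‖z‖ ^ (M + 1) * max 1 (Real.exp z.re) := by
      intro t ht
      rw [norm_mul, pow_succ', mul_assoc]
      refine mul_le_mul_of_nonneg_left ((ih _).trans ?_) (norm_nonneg _)
      have h1 : ‖(t : ℂ) * z‖ ≤ ‖z‖ := by
        rw [norm_mul, norm_real, Real.norm_eq_abs, abs_of_nonneg ht.1]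
        exact mul_le_of_le_one_left (norm_nonneg _) ht.2.le
      have h2 : max 1 (Real.exp ((t : ℂ) * z).re) ≤ max 1 (Real.exp z.re) := by
        refine max_le (le_max_left _ _) ?_
        rw [re_ofReal_mul]
        rcases le_total 0 z.re with h | h
        · exact (Real.exp_le_exp.2 (mul_le_of_le_one_left h ht.2.le)).trans (le_max_right _ _)
        · refine le_trans ?_ (le_max_left _ _)
          exact Real.exp_le_one_iff.2 (mul_nonpos_of_nonneg_of_nonpos ht.1 h)
      gcongr
    have := norm_image_sub_le_of_norm_deriv_le_segment_01' (fun t _ => (hd t).hasDerivWithinAt)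
      hbound
    have h0 : R 0 = 0 := by
      simp [hR, Finset.sum_range_succ']
    rw [h0, sub_zero] at this
    simpa [hR] using this

lemma integrable_pow_mul_cexp_neg_mul_sq {b : ℂ} (hb : 0 < b.re) (m : ℕ) :
    MeasureTheory.Integrable fun x : ℝ => (x : ℂ) ^ m * exp (-b * (x : ℂ) ^ 2) := by
  have h := integrable_rpow_mul_exp_neg_mul_sq hb (s := m) (by linarith [m.cast_nonneg (α := ℝ)])
  refine h.mono (Continuous.aestronglyMeasurable (by fun_prop)) (Eventually.of_forall fun x => ?_)
  rw [norm_mul, norm_mul, norm_exp, Real.rpow_natCast, norm_pow, norm_real, norm_pow,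
    Real.norm_of_nonneg (Real.exp_pos _).le, ← ofReal_pow, re_mul_ofReal, neg_re]

/-- Integration by parts: the derivative of x^{m+1}exp(-bx²) has integral zero. -/
lemma integral_pow_succ_succ_mul_cexp {b : ℂ} (hb : 0 < b.re) (m : ℕ) :
    2 * b * ∫ x : ℝ, (x : ℂ) ^ (m + 2) * exp (-b * (x : ℂ) ^ 2)
      = (m + 1) * ∫ x : ℝ, (x : ℂ) ^ m * exp (-b * (x : ℂ) ^ 2) := by
  have hd : ∀ x : ℝ, HasDerivAt (fun x : ℝ => (x : ℂ) ^ (m + 1) * exp (-b * (x : ℂ) ^ 2))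
      ((m + 1) * ((x : ℂ) ^ m * exp (-b * (x : ℂ) ^ 2))
        - 2 * b * ((x : ℂ) ^ (m + 2) * exp (-b * (x : ℂ) ^ 2))) x := by
    intro x
    have h1 : HasDerivAt (fun z : ℂ => z ^ (m + 1) * exp (-b * z ^ 2))
        ((m + 1) * ((x : ℂ) ^ m * exp (-b * (x : ℂ) ^ 2))
        - 2 * b * ((x : ℂ) ^ (m + 2) * exp (-b * (x : ℂ) ^ 2))) x := by
      refine ((hasDerivAt_pow (m + 1) (x : ℂ)).mul
        (((hasDerivAt_pow 2 (x : ℂ)).const_mul (-b)).cexp)).congr_deriv ?_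
      simp only [Nat.add_sub_cancel]
      push_cast
      ring
    exact h1.comp_ofReal
  have i1 := (integrable_pow_mul_cexp_neg_mul_sq hb m).const_mul ((m : ℂ) + 1)
  have i2 := (integrable_pow_mul_cexp_neg_mul_sq hb (m + 2)).const_mul (2 * b)
  have h := MeasureTheory.integral_eq_zero_of_hasDerivAt_of_integrable hd (i1.sub i2)
    (integrable_pow_mul_cexp_neg_mul_sq hb (m + 1))
  rw [MeasureTheory.integral_sub i1 i2, MeasureTheory.integral_const_mul,
    MeasureTheory.integral_const_mul] at h
  linear_combination -h

lemma integral_odd_pow_mul_cexp (b : ℂ) (n : ℕ) :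
    ∫ x : ℝ, (x : ℂ) ^ (2 * n + 1) * exp (-b * (x : ℂ) ^ 2) = 0 := by
  have h := MeasureTheory.integral_neg_eq_self
    (fun x : ℝ => (x : ℂ) ^ (2 * n + 1) * exp (-b * (x : ℂ) ^ 2)) MeasureTheory.volume
  have h2 : ∀ x : ℝ, ((-x : ℝ) : ℂ) ^ (2 * n + 1) * exp (-b * ((-x : ℝ) : ℂ) ^ 2)
      = -((x : ℂ) ^ (2 * n + 1) * exp (-b * (x : ℂ) ^ 2)) := by
    intro x
    push_cast
    rw [Odd.neg_pow ⟨n, rfl⟩, neg_sq]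
    ring
  simp only [h2, MeasureTheory.integral_neg] at h
  linear_combination (-1 / 2) * h

lemma integral_even_pow_mul_cexp {b : ℂ} (hb : 0 < b.re) (n : ℕ) :
    ∫ x : ℝ, (x : ℂ) ^ (2 * n) * exp (-b * (x : ℂ) ^ 2)
      = (Real.pi / b) ^ (1 / 2 : ℂ) * (Real.Gamma (n + 1 / 2) : ℂ) / (Real.sqrt Real.pi * b ^ n) := by
  have hspi : (Real.sqrt Real.pi : ℂ) ≠ 0 := by
    exact_mod_cast (Real.sqrt_pos.2 Real.pi_pos).ne'
  have hb0 : b ≠ 0 := by rintro rfl; simp at hb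
  induction n with
  | zero =>
    have h1 : ∫ x : ℝ, (x : ℂ) ^ (2 * 0) * exp (-b * (x : ℂ) ^ 2)
        = (Real.pi / b) ^ (1 / 2 : ℂ) := by
      simpa using integral_gaussian_complex hb
    rw [h1]
    simp only [Nat.cast_zero, zero_add, Real.Gamma_one_half_eq, pow_zero, mul_one]
    field_simp
  | succ n ih =>
    have h := integral_pow_succ_succ_mul_cexp hb (2 * n)
    rw [ih] at h
    have hG : Real.Gamma ((n + 1 : ℕ) + 1 / 2) = (n + 1 / 2) * Real.Gamma (n + 1 / 2) := by
      rw [← Real.Gamma_add_one (by positivity)]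
      congr 1
      push_cast
      ring
    have h2 : (2 : ℂ) * b ≠ 0 := by simpa using hb0
    refine mul_left_cancel₀ h2 ?_
    rw [show 2 * (n + 1) = 2 * n + 2 by ring, h, hG, pow_succ]
    push_cast
    field_simp

/-! ### Pointwise error of the double truncation. -/

section pointwise

variable {p q : PowerSeries ℂ} {K K' : ℝ} {a : ℂ} {M : ℕ} {x w : ℝ}

/-- The terms of `p exp (w q)` of degree less than `M` in `x` and in `w`. -/
def truncSum (p q : PowerSeries ℂ) (M : ℕ) (x w : ℝ) : ℂ :=
  ∑ n ∈ Finset.range M, ∑ k ∈ Finset.range M,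
    PowerSeries.coeff n (p * q ^ k) / (k.factorial : ℂ) * ((x : ℂ) ^ n * (w : ℂ) ^ k)

/-- Adds up the majorants of p q^k for k < M; the factor 4^M comes from the tail bound (4|x|)^M. -/
def truncConst (K K' : ℝ) (M : ℕ) : ℝ := ∑ k ∈ Finset.range M, K * K' ^ k * 4 ^ M

lemma truncConst_nonneg (hK : 0 ≤ K) (hK' : 0 ≤ K') : 0 ≤ truncConst K K' M :=
  Finset.sum_nonneg fun k _ => by positivity

lemma pow_le_one_add_pow (hw : 0 ≤ w) {k : ℕ} (hk : k ≤ M) : w ^ k ≤ (1 + w) ^ M :=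
  (pow_le_pow_left₀ hw (by linarith) k).trans (pow_le_pow_right₀ (by linarith) hk)

lemma norm_inv_factorial_le (k : ℕ) : ‖((k.factorial : ℂ))⁻¹‖ ≤ 1 := by
  rw [norm_inv, norm_natCast]
  exact inv_le_one_of_one_le₀ (by exact_mod_cast k.factorial_pos)

/-- There are two errors: the Taylor remainder of the exponential at w q(x), and the tails in x of p
q^k for k < M. Since q(0) = 0, the power (w q(x))^M already contains |x|^M, so both have the same
shape. -/
lemma norm_sub_truncSum_le (hp : WBound p K) (hq : WBound q K') (hq0 : PowerSeries.coeff 0 q = 0)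
    (hx : |x| ≤ 1 / 4) (hw : 0 ≤ w) (hre : (evalSeries q x).re ≤ a.re - 1 / 2)
    (ha : 1 / 2 ≤ a.re) :
    ‖evalSeries p x * exp (w * (evalSeries q x - a)) - exp (-(a * w)) * truncSum p q M x w‖
      ≤ (K * (4 * K') ^ M + truncConst K K' M) * (|x| ^ M * (1 + w) ^ M * Real.exp (-w / 2)) := by
  have hK := hp.nonneg
  have hK' := hq.nonneg
  have e1 : evalSeries p x * exp (w * (evalSeries q x - a)) - exp (-(a * w)) * truncSum p q M x w
      = exp (-(a * w)) * (evalSeries p x * (exp (w * evalSeries q x)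
          - ∑ k ∈ Finset.range M, ((w : ℂ) * evalSeries q x) ^ k / (k.factorial : ℂ)))
        + exp (-(a * w)) * ∑ k ∈ Finset.range M, ((k.factorial : ℂ))⁻¹ * (w : ℂ) ^ k *
          (evalSeries (p * q ^ k) x
            - ∑ n ∈ Finset.range M, PowerSeries.coeff n (p * q ^ k) * (x : ℂ) ^ n) := by
    have h1 : exp (w * (evalSeries q x - a)) = exp (-(a * w)) * exp (w * evalSeries q x) := by
      rw [← exp_add]
      ring_nf
    have h2 : truncSum p q M x w = ∑ k ∈ Finset.range M, ((k.factorial : ℂ))⁻¹ * (w : ℂ) ^ k *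
        ∑ n ∈ Finset.range M, PowerSeries.coeff n (p * q ^ k) * (x : ℂ) ^ n := by
      rw [truncSum, Finset.sum_comm]
      refine Finset.sum_congr rfl fun k _ => ?_
      rw [Finset.mul_sum]
      refine Finset.sum_congr rfl fun n _ => ?_
      ring
    have h3 : ∑ k ∈ Finset.range M, ((k.factorial : ℂ))⁻¹ * (w : ℂ) ^ k * evalSeries (p * q ^ k) x
        = evalSeries p x *
          ∑ k ∈ Finset.range M, ((w : ℂ) * evalSeries q x) ^ k / (k.factorial : ℂ) := by
      rw [Finset.mul_sum]
      refine Finset.sum_congr rfl fun k _ => ?_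
      rw [hp.evalSeries_mul_pow hq hx, mul_pow]
      ring
    rw [h1]
    simp only [mul_sub, Finset.sum_sub_distrib]
    rw [h3, h2]
    ring
  have hexp : ‖exp (-(a * w))‖ = Real.exp (-(a.re * w)) := by
    rw [norm_exp, neg_re, re_mul_ofReal]
  have hqx : ‖evalSeries q x‖ ≤ K' * (4 * |x|) := by
    simpa [hq0] using hq.norm_evalSeries_sub_le hx 1
  have b1 : ‖exp (-(a * w)) * (evalSeries p x * (exp (w * evalSeries q x)
          - ∑ k ∈ Finset.range M, ((w : ℂ) * evalSeries q x) ^ k / (k.factorial : ℂ)))‖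
      ≤ K * (4 * K') ^ M * (|x| ^ M * (1 + w) ^ M * Real.exp (-w / 2)) := by
    have h1 := norm_exp_sub_sum_le_max M (w * evalSeries q x)
    have h2 : ‖(w : ℂ) * evalSeries q x‖ ≤ (1 + w) * (K' * (4 * |x|)) := by
      rw [norm_mul, norm_real, Real.norm_eq_abs, abs_of_nonneg hw]
      gcongr
      linarith
    -- The value 1 of the maximum is absorbed using Re a ≥ 1/2, the exponential using Re q(x) ≤ Re a
    -- - 1/2. A remainder bound with exp|z| would not suffice here.
    have h3 : Real.exp (-(a.re * w)) * max 1 (Real.exp ((w : ℂ) * evalSeries q x).re)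
        ≤ Real.exp (-w / 2) := by
      rw [mul_max_of_nonneg _ _ (Real.exp_pos _).le, re_ofReal_mul, mul_one, ← Real.exp_add]
      refine max_le (Real.exp_le_exp.2 ?_) (Real.exp_le_exp.2 ?_) <;> nlinarith
    rw [norm_mul, norm_mul, hexp]
    calc _ ≤ Real.exp (-(a.re * w)) * (K * (((1 + w) * (K' * (4 * |x|))) ^ M
          * max 1 (Real.exp ((w : ℂ) * evalSeries q x).re))) := by
          gcongr
          · exact hp.norm_evalSeries_le hx
          · exact h1.trans (by gcongr)
      _ = K * ((1 + w) * (K' * (4 * |x|))) ^ M * (Real.exp (-(a.re * w))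
          * max 1 (Real.exp ((w : ℂ) * evalSeries q x).re)) := by ring
      _ ≤ K * ((1 + w) * (K' * (4 * |x|))) ^ M * Real.exp (-w / 2) := by gcongr
      _ = _ := by simp only [mul_pow]; ring
  have b2 : ‖exp (-(a * w)) * ∑ k ∈ Finset.range M, ((k.factorial : ℂ))⁻¹ * (w : ℂ) ^ k *
          (evalSeries (p * q ^ k) x
            - ∑ n ∈ Finset.range M, PowerSeries.coeff n (p * q ^ k) * (x : ℂ) ^ n)‖
      ≤ truncConst K K' M * (|x| ^ M * (1 + w) ^ M * Real.exp (-w / 2)) := by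
    rw [norm_mul, hexp]
    have h1 : Real.exp (-(a.re * w)) ≤ Real.exp (-w / 2) := Real.exp_le_exp.2 (by nlinarith)
    have h2 : ∀ k ∈ Finset.range M, ‖((k.factorial : ℂ))⁻¹ * (w : ℂ) ^ k *
          (evalSeries (p * q ^ k) x
            - ∑ n ∈ Finset.range M, PowerSeries.coeff n (p * q ^ k) * (x : ℂ) ^ n)‖
        ≤ K * K' ^ k * 4 ^ M * (|x| ^ M * (1 + w) ^ M) := by
      intro k hk
      rw [norm_mul, norm_mul, norm_pow, norm_real, Real.norm_eq_abs, abs_of_nonneg hw]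
      calc _ ≤ 1 * (1 + w) ^ M * (K * K' ^ k * (4 * |x|) ^ M) := by
            gcongr
            · exact norm_inv_factorial_le k
            · exact pow_le_one_add_pow hw (Finset.mem_range.1 hk).le
            · exact (hp.mul_pow hq k).norm_evalSeries_sub_le hx M
        _ = _ := by simp only [mul_pow]; ring
    calc _ ≤ Real.exp (-w / 2) * ∑ k ∈ Finset.range M, K * K' ^ k * 4 ^ M * (|x| ^ M * (1 + w) ^ M) :=
          mul_le_mul h1 ((norm_sum_le _ _).trans (Finset.sum_le_sum h2)) (norm_nonneg _)
            (Real.exp_pos _).le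
      _ = _ := by rw [← Finset.sum_mul, truncConst]; ring
  rw [e1, add_mul]
  exact (norm_add_le _ _).trans (add_le_add b1 b2)

/-- Extending the truncated integral beyond |x| = 1/4 costs no more than the truncation: there 4|x|
≥ 1, so each monomial of lower degree is dominated by (4|x|)^M. -/
lemma norm_truncSum_le (hp : WBound p K) (hq : WBound q K') (hx : 1 / 4 ≤ |x|) (hw : 0 ≤ w)
    (ha : 1 / 2 ≤ a.re) :
    ‖exp (-(a * w)) * truncSum p q M x w‖
      ≤ M * truncConst K K' M * (|x| ^ M * (1 + w) ^ M * Real.exp (-w / 2)) := by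
  have hK := hp.nonneg
  have hK' := hq.nonneg
  have hexp : ‖exp (-(a * w))‖ ≤ Real.exp (-w / 2) := by
    rw [norm_exp, neg_re, re_mul_ofReal]
    exact Real.exp_le_exp.2 (by nlinarith)
  have h1 : ‖truncSum p q M x w‖ ≤ ∑ n ∈ Finset.range M, ∑ k ∈ Finset.range M,
      K * K' ^ k * 4 ^ M * (|x| ^ M * (1 + w) ^ M) := by
    refine (norm_sum_le _ _).trans (Finset.sum_le_sum fun n hn => ?_)
    refine (norm_sum_le _ _).trans (Finset.sum_le_sum fun k hk => ?_)
    have h2 := (hp.mul_pow hq k).norm_coeff_le n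
    have h3 : (4 * |x|) ^ n ≤ (4 * |x|) ^ M :=
      pow_le_pow_right₀ (by linarith) (Finset.mem_range.1 hn).le
    rw [div_eq_mul_inv, norm_mul, norm_mul, norm_mul, norm_pow, norm_pow, norm_real, norm_real,
      Real.norm_eq_abs, Real.norm_eq_abs, abs_of_nonneg hw]
    calc _ ≤ (K * K' ^ k * 4 ^ n) * 1 * (|x| ^ n * (1 + w) ^ M) := by
          gcongr
          · exact norm_inv_factorial_le k
          · exact pow_le_one_add_pow hw (Finset.mem_range.1 hk).le
      _ = K * K' ^ k * (1 + w) ^ M * (4 * |x|) ^ n := by rw [mul_pow]; ring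
      _ ≤ K * K' ^ k * (1 + w) ^ M * (4 * |x|) ^ M := by gcongr
      _ = _ := by rw [mul_pow]; ring
  rw [norm_mul]
  calc _ ≤ Real.exp (-w / 2) * (∑ n ∈ Finset.range M, ∑ k ∈ Finset.range M,
      K * K' ^ k * 4 ^ M * (|x| ^ M * (1 + w) ^ M)) :=
        mul_le_mul hexp h1 (norm_nonneg _) (Real.exp_pos _).le
    _ = _ := by
        rw [Finset.sum_const, Finset.card_range, nsmul_eq_mul, ← Finset.sum_mul, truncConst]
        ring

end pointwise

/-- Half of the decay in w absorbs the polynomial factor; the other half stays integrable. -/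
lemma one_add_pow_mul_exp_le (m : ℕ) {w : ℝ} (hw : 0 ≤ w) :
    (1 + w) ^ m * Real.exp (-w / 2) ≤ 4 ^ m * m.factorial * Real.exp (1 / 4) * Real.exp (-w / 4) := by
  have h := Real.pow_div_factorial_le_exp ((1 + w) / 4) (by linarith) m
  rw [div_le_iff₀ (by positivity), div_pow, div_le_iff₀ (by positivity)] at h
  calc _ ≤ Real.exp ((1 + w) / 4) * m.factorial * 4 ^ m * Real.exp (-w / 2) := by gcongr
    _ = 4 ^ m * m.factorial * (Real.exp ((1 + w) / 4) * Real.exp (-w / 2)) := by ring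
    _ = 4 ^ m * m.factorial * (Real.exp (1 / 4) * Real.exp (-w / 4)) := by
        rw [← Real.exp_add, ← Real.exp_add]
        ring_nf
    _ = _ := by ring

/-! ### Laplace's method. -/

section laplace

variable {p q : PowerSeries ℂ} {K K' : ℝ} {a : ℂ}

lemma WBound.continuousOn (hp : WBound p K) :
    ContinuousOn (evalSeries p) (Set.Icc (-(1 / 4)) (1 / 4)) := by
  refine continuousOn_tsum (fun n => by fun_prop) hp.1 fun n x hx => ?_
  have hx : |x| ≤ 1 / 4 := abs_le.2 hx
  rw [norm_mul, norm_pow, norm_real, Real.norm_eq_abs]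
  gcongr

/-- The sum of the moments of the terms of `p exp (w q)`, without the factor `√(τ/a)`. -/
def momentSum (p q : PowerSeries ℂ) (a : ℂ) (τ : ℝ) (N : ℕ) : ℂ :=
  ∑ n ∈ Finset.range N, (∑ k ∈ Finset.range (2 * n + 1), (Real.Gamma (n + k + 1 / 2) : ℂ)
    * (PowerSeries.coeff (2 * n) (p * q ^ k) / (k.factorial : ℂ)) / a ^ (n + k)) * (τ : ℂ) ^ n

/-- Since x divides q, only k ≤ n contributes. This reconciles the square range of the truncation
with the triangular range in F_n. -/
lemma coeff_mul_pow_eq_zero (hq0 : PowerSeries.coeff 0 q = 0) {n k : ℕ} (h : n < k) :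
    PowerSeries.coeff n (p * q ^ k) = 0 := by
  have h1 : (PowerSeries.X : PowerSeries ℂ) ∣ q := by
    rw [PowerSeries.X_dvd_iff, ← PowerSeries.coeff_zero_eq_constantCoeff_apply, hq0]
  have h2 : (PowerSeries.X : PowerSeries ℂ) ^ k ∣ p * q ^ k :=
    Dvd.dvd.mul_left (pow_dvd_pow_of_dvd h1 k) p
  exact PowerSeries.X_pow_dvd_iff.1 h2 n h

lemma truncSum_integrand (M : ℕ) (τ x : ℝ) :
    exp (-(a * (x ^ 2 / τ : ℝ))) * truncSum p q M x (x ^ 2 / τ)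
      = ∑ n ∈ Finset.range M, ∑ k ∈ Finset.range M,
        (PowerSeries.coeff n (p * q ^ k) / (k.factorial : ℂ) / (τ : ℂ) ^ k)
          * ((x : ℂ) ^ (n + 2 * k) * exp (-(a / τ) * (x : ℂ) ^ 2)) := by
  rw [truncSum, Finset.mul_sum]
  refine Finset.sum_congr rfl fun n _ => ?_
  rw [Finset.mul_sum]
  refine Finset.sum_congr rfl fun k _ => ?_
  rw [show -(a * ((x ^ 2 / τ : ℝ) : ℂ)) = -(a / τ) * (x : ℂ) ^ 2 by push_cast; ring]
  push_cast
  rw [div_pow, ← pow_mul, pow_add]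
  ring

lemma re_div_pos (ha : 1 / 2 ≤ a.re) {τ : ℝ} (hτ : 0 < τ) : 0 < (a / τ).re := by
  rw [div_ofReal_re]
  positivity

lemma integrable_truncSum (ha : 1 / 2 ≤ a.re) {τ : ℝ} (hτ : 0 < τ) (M : ℕ) :
    MeasureTheory.Integrable fun x : ℝ =>
      exp (-(a * (x ^ 2 / τ : ℝ))) * truncSum p q M x (x ^ 2 / τ) := by
  simp only [truncSum_integrand]
  refine MeasureTheory.integrable_finsetSum _ fun n _ =>
    MeasureTheory.integrable_finsetSum _ fun k _ => ?_
  exact (integrable_pow_mul_cexp_neg_mul_sq (re_div_pos ha hτ) _).const_mul _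

lemma sum_range_two_mul {β : Type*} [AddCommMonoid β] (g : ℕ → β) (N : ℕ)
    (hg : ∀ n, g (2 * n + 1) = 0) :
    ∑ n ∈ Finset.range (2 * N), g n = ∑ n ∈ Finset.range N, g (2 * n) := by
  induction N with
  | zero => simp
  | succ N ih => rw [show 2 * (N + 1) = 2 * N + 1 + 1 by ring, Finset.sum_range_succ,
      Finset.sum_range_succ, ih, hg, add_zero, Finset.sum_range_succ]

/-- Odd moments vanish; the term x^{2n}w^k gives the moment of order 2(n+k), in which τ^{n+k} is
reduced to τ^n by the τ^{-k} in w^k. -/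
lemma integral_truncSum (hq0 : PowerSeries.coeff 0 q = 0) (ha : 1 / 2 ≤ a.re) {τ : ℝ} (hτ : 0 < τ)
    (N : ℕ) :
    ∫ x : ℝ, exp (-(a * (x ^ 2 / τ : ℝ))) * truncSum p q (2 * N) x (x ^ 2 / τ)
      = (Real.pi / (a / τ)) ^ (1 / 2 : ℂ) / Real.sqrt Real.pi * momentSum p q a τ N := by
  have hb := re_div_pos ha hτ
  have ha0 : a ≠ 0 := by rintro rfl; norm_num at ha
  have hτ0 : (τ : ℂ) ≠ 0 := by exact_mod_cast hτ.ne'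
  simp only [truncSum_integrand]
  rw [MeasureTheory.integral_finsetSum _ fun n _ =>
    MeasureTheory.integrable_finsetSum _ fun k _ =>
      (integrable_pow_mul_cexp_neg_mul_sq hb _).const_mul _]
  simp only [MeasureTheory.integral_finsetSum _ fun k _ =>
      (integrable_pow_mul_cexp_neg_mul_sq hb _).const_mul _, MeasureTheory.integral_const_mul]
  rw [sum_range_two_mul]
  · rw [momentSum, Finset.mul_sum]
    refine Finset.sum_congr rfl fun n hn => ?_
    have hn := Finset.mem_range.1 hn
    rw [Finset.sum_mul, Finset.mul_sum]
    rw [← Finset.sum_subset (Finset.range_subset_range.2 (show 2 * n + 1 ≤ 2 * N by omega))]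
    · refine Finset.sum_congr rfl fun k _ => ?_
      have h := integral_even_pow_mul_cexp hb (n + k)
      rw [show 2 * n + 2 * k = 2 * (n + k) by ring, h, div_pow]
      push_cast
      rw [pow_add (τ : ℂ)]
      field_simp
    · intro k _ hk
      have hk : 2 * n < k := by
        rw [Finset.mem_range] at hk
        omega
      rw [coeff_mul_pow_eq_zero hq0 hk]
      simp
  · intro n
    refine Finset.sum_eq_zero fun k _ => ?_
    rw [show 2 * n + 1 + 2 * k = 2 * (n + k) + 1 by ring, integral_odd_pow_mul_cexp, mul_zero]

/-- The constant in the error bound of Laplace's method. -/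
def laplaceConst (K K' : ℝ) (N : ℕ) : ℝ :=
  (K * (4 * K') ^ (2 * N) + truncConst K K' (2 * N) + (2 * N : ℕ) * truncConst K K' (2 * N))
    * (4 ^ (3 * N) * (3 * N).factorial * Real.exp (1 / 4))

lemma norm_integrand_sub_le (hp : WBound p K) (hq : WBound q K')
    (hq0 : PowerSeries.coeff 0 q = 0) {τ : ℝ} (hτ : 0 < τ)
    (hre : ∀ x : ℝ, |x| ≤ 1 / 4 → (evalSeries q x).re ≤ a.re - 1 / 2) (ha : 1 / 2 ≤ a.re) (N : ℕ)
    (x : ℝ) :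
    ‖(Set.Ioc (-(1 / 4) : ℝ) (1 / 4)).indicator
        (fun x : ℝ => evalSeries p x * exp ((x ^ 2 / τ : ℝ) * (evalSeries q x - a))) x
      - exp (-(a * (x ^ 2 / τ : ℝ))) * truncSum p q (2 * N) x (x ^ 2 / τ)‖
      ≤ laplaceConst K K' N * τ ^ N * Real.exp (-(1 / (4 * τ)) * x ^ 2) := by
  have hK := hp.nonneg
  have hK' := hq.nonneg
  have hT := truncConst_nonneg (M := 2 * N) hK hK'
  have hw : 0 ≤ x ^ 2 / τ := by positivity
  set w := x ^ 2 / τ with hwdef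
  have h1 : ‖(Set.Ioc (-(1 / 4) : ℝ) (1 / 4)).indicator
        (fun x : ℝ => evalSeries p x * exp ((x ^ 2 / τ : ℝ) * (evalSeries q x - a))) x
      - exp (-(a * w)) * truncSum p q (2 * N) x w‖ ≤
      (K * (4 * K') ^ (2 * N) + truncConst K K' (2 * N) + (2 * N : ℕ) * truncConst K K' (2 * N))
        * (|x| ^ (2 * N) * (1 + w) ^ (2 * N) * Real.exp (-w / 2)) := by
    -- On the segment the error is that of truncation; off it the indicator vanishes and the
    -- extended truncation itself is the error.
    by_cases hx : x ∈ Set.Ioc (-(1 / 4) : ℝ) (1 / 4)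
    · rw [Set.indicator_of_mem hx]
      have hx' : |x| ≤ 1 / 4 := abs_le.2 ⟨hx.1.le, hx.2⟩
      refine (norm_sub_truncSum_le hp hq hq0 hx' hw (hre x hx') ha).trans ?_
      exact mul_le_mul_of_nonneg_right (le_add_of_nonneg_right (by positivity)) (by positivity)
    · rw [Set.indicator_of_notMem hx, zero_sub, norm_neg]
      have hx' : 1 / 4 ≤ |x| := by
        by_contra h
        have := abs_lt.1 (not_le.1 h)
        exact hx ⟨this.1, this.2.le⟩
      refine (norm_truncSum_le hp hq hx' hw ha).trans ?_
      exact mul_le_mul_of_nonneg_right (le_add_of_nonneg_left (by positivity)) (by positivity)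
  refine h1.trans ?_
  -- The source of the gain τ^N; the leftover w^N joins (1+w)^{2N}, hence the exponent 3N in the
  -- constant.
  have h2 : |x| ^ (2 * N) = τ ^ N * w ^ N := by
    rw [pow_mul, sq_abs, hwdef, ← mul_pow]
    congr 1
    field_simp
  have h3 := one_add_pow_mul_exp_le (3 * N) hw
  have h4 : w ^ N ≤ (1 + w) ^ N := pow_le_pow_left₀ hw (by linarith) N
  have h5 : Real.exp (-w / 4) = Real.exp (-(1 / (4 * τ)) * x ^ 2) := by
    congr 1
    rw [hwdef]
    field_simp
  rw [laplaceConst, ← h5, h2]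
  calc _ ≤ (K * (4 * K') ^ (2 * N) + truncConst K K' (2 * N)
        + (2 * N : ℕ) * truncConst K K' (2 * N))
        * (τ ^ N * (1 + w) ^ N * (1 + w) ^ (2 * N) * Real.exp (-w / 2)) := by gcongr
    _ = (K * (4 * K') ^ (2 * N) + truncConst K K' (2 * N)
        + (2 * N : ℕ) * truncConst K K' (2 * N)) * τ ^ N
        * ((1 + w) ^ (3 * N) * Real.exp (-w / 2)) := by ring
    _ ≤ (K * (4 * K') ^ (2 * N) + truncConst K K' (2 * N)
        + (2 * N : ℕ) * truncConst K K' (2 * N)) * τ ^ N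
        * (4 ^ (3 * N) * (3 * N).factorial * Real.exp (1 / 4) * Real.exp (-w / 4)) := by gcongr
    _ = _ := by ring

/-- Laplace's method with an explicit, uniform error bound. -/
lemma laplace_expansion (hp : WBound p K) (hq : WBound q K')
    (hq0 : PowerSeries.coeff 0 q = 0) {τ : ℝ} (hτ : 0 < τ)
    (hre : ∀ x : ℝ, |x| ≤ 1 / 4 → (evalSeries q x).re ≤ a.re - 1 / 2) (N : ℕ) :
    ‖(∫ x in (-(1 / 4) : ℝ)..(1 / 4),
          evalSeries p x * exp ((x ^ 2 / τ : ℝ) * (evalSeries q x - a)))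
      - (Real.pi / (a / τ)) ^ (1 / 2 : ℂ) / Real.sqrt Real.pi * momentSum p q a τ N‖
      ≤ laplaceConst K K' N * Real.sqrt (4 * Real.pi) * τ ^ N * Real.sqrt τ := by
  have ha : 1 / 2 ≤ a.re := by
    have h0 : evalSeries q 0 = 0 := by
      rw [evalSeries, tsum_eq_single 0]
      · simp [hq0]
      · intro n hn
        simp [hn]
    have := hre 0 (by norm_num)
    rw [h0, zero_re] at this
    linarith
  have hc : ContinuousOn
      (fun x : ℝ => evalSeries p x * exp ((x ^ 2 / τ : ℝ) * (evalSeries q x - a)))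
      (Set.Icc (-(1 / 4) : ℝ) (1 / 4)) := by
    have h1 := hp.continuousOn
    have h2 := hq.continuousOn
    fun_prop
  have hi : MeasureTheory.Integrable ((Set.Ioc (-(1 / 4) : ℝ) (1 / 4)).indicator
      (fun x : ℝ => evalSeries p x * exp ((x ^ 2 / τ : ℝ) * (evalSeries q x - a)))) := by
    rw [MeasureTheory.integrable_indicator_iff measurableSet_Ioc]
    exact (hc.integrableOn_compact isCompact_Icc).mono_set Set.Ioc_subset_Icc_self
  rw [intervalIntegral.integral_of_le (by norm_num),
    ← MeasureTheory.integral_indicator measurableSet_Ioc, ← integral_truncSum hq0 ha hτ,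
    ← MeasureTheory.integral_sub hi (integrable_truncSum ha hτ _)]
  have hb : (0 : ℝ) < 1 / (4 * τ) := by positivity
  refine (MeasureTheory.norm_integral_le_of_norm_le
    ((integrable_exp_neg_mul_sq hb).const_mul (laplaceConst K K' N * τ ^ N))
    (Eventually.of_forall fun x => norm_integrand_sub_le hp hq hq0 hτ hre ha N x)).trans
    (le_of_eq ?_)
  rw [MeasureTheory.integral_const_mul, integral_gaussian,
    show Real.pi / (1 / (4 * τ)) = 4 * Real.pi * τ by field_simp, Real.sqrt_mul (by positivity)]
  ring

end laplace

/-! ### Bounds for the amplitude and the exponent, uniform in τ. -/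

lemma WBound.of_le {p : PowerSeries ℂ} {g : ℕ → ℝ} (hg : Summable g)
    (h : ∀ n, ‖PowerSeries.coeff n p‖ * (1 / 4) ^ n ≤ g n) : WBound p (∑' n, g n) := by
  have hs := Summable.of_nonneg_of_le (fun n => by positivity) h hg
  exact ⟨hs, hs.tsum_le_tsum h hg⟩

lemma exp_le_of_le {x y : ℝ} (hx : x < 1) (h : 1 ≤ y * (1 - x)) : Real.exp x ≤ y := by
  have h1 := Real.add_one_le_exp (-x)
  have h2 : Real.exp x * Real.exp (-x) = 1 := by rw [← Real.exp_add]; simp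
  have h3 : 0 < Real.exp x := Real.exp_pos x
  nlinarith

lemma norm_eps : ‖eps‖ = 1 := by
  rw [eps, show (Real.pi * I / 4 : ℂ) = ((Real.pi / 4 : ℝ) : ℂ) * I by push_cast; ring,
    norm_exp_ofReal_mul_I]

/-- The radius 11/20 is the product of the growth rate 11/10 of the B_n, the factor 2 = |2ε| and the
weight 1/4. It lies inside the unit disc of the binomial series. -/
lemma summable_norm_choose : Summable fun n : ℕ => ‖Ring.choose (-5 / 2 : ℂ) n‖ * (11 / 20) ^ n := by
  have h := (binomialSeries ℂ (-5 / 2 : ℂ)).summable_norm_mul_pow (r := 11 / 20)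
    (lt_of_lt_of_le (by rw [← ENNReal.coe_one, ENNReal.coe_lt_coe]; exact (by norm_num : (11 / 20 : ℝ) < 1)) binomialSeries_radius_ge_one)
  refine h.congr fun n => ?_
  rw [binomialSeries, FormalMultilinearSeries.ofScalars_norm]
  norm_num

namespace SaddleData

variable {τ : ℝ} {s L : ℂ}

lemma norm_exp_le (h : SaddleData τ s L) : ‖exp (-L / 2)‖ ≤ 11 / 10 := by
  refine (norm_exp_le_exp_norm _).trans ?_
  have h1 : ‖-L / 2‖ ≤ 1 / 200 := by
    rw [norm_div, norm_neg]
    norm_num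
    linarith [h.norm_lt]
  exact (Real.exp_le_exp.2 h1).trans (exp_le_of_le (by norm_num) (by norm_num))

lemma norm_B_succ_le (h : SaddleData τ s L) (n : ℕ) : ‖B (n + 1) τ‖ ≤ 2 * (11 / 10) ^ (n + 1) := by
  have h1 : exp ((-5 / 2 - (n + 1 : ℕ)) * (L / 2)) = exp (-5 / 4 * L) * exp (-L / 2) ^ (n + 1) := by
    rw [← exp_nat_mul, ← exp_add]
    ring_nf
  have h2 : ‖exp (-5 / 4 * L)‖ ≤ 2 := by
    refine (norm_exp_le_exp_norm _).trans ?_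
    have h1 : ‖-5 / 4 * L‖ ≤ 1 / 80 := by
      rw [norm_mul]
      norm_num
      linarith [h.norm_lt]
    exact (Real.exp_le_exp.2 h1).trans (exp_le_of_le (by norm_num) (by norm_num))
  rw [h.B_eq, h1, norm_mul, norm_pow]
  gcongr
  exact h.norm_exp_le

lemma norm_A_le (h : SaddleData τ s L) (m : ℕ) : ‖A (m + 2) τ‖ ≤ 7 * (11 / 10) ^ m := by
  have hτ := h.pos
  have hτ1 := h.lt
  have h0 : ‖(τ : ℂ)‖ = τ := by rw [norm_real, Real.norm_eq_abs, abs_of_pos hτ]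
  have h1 : ‖((1 + s) ^ (m + 2))⁻¹‖ ≤ 1 := by
    rw [norm_inv, norm_pow]
    refine inv_le_one_of_one_le₀ (one_le_pow₀ ?_)
    have := re_le_norm (1 + s)
    rw [add_re, one_re] at this
    linarith [h.pos_re]
  have h2 : ‖I / (((m : ℂ) + 2) * 2 ^ (m + 3))‖ ≤ 1 / 16 := by
    rw [norm_div, norm_I, norm_mul, norm_pow, show (m : ℂ) + 2 = ((m + 2 : ℕ) : ℂ) by push_cast; ring,
      norm_natCast]
    have h3 : (16 : ℝ) ≤ ((m + 2 : ℕ) : ℝ) * ‖(2 : ℂ)‖ ^ (m + 3) := by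
      have h4 : (2 : ℝ) ≤ ((m + 2 : ℕ) : ℝ) := by push_cast; linarith [m.cast_nonneg (α := ℝ)]
      have h5 : (2 : ℝ) ^ 3 ≤ 2 ^ (m + 3) := pow_le_pow_right₀ (by norm_num) (by omega)
      rw [Complex.norm_two]
      nlinarith
    exact one_div_le_one_div_of_le (by norm_num) h3
  have h3 : ‖(τ : ℂ) ^ (m + 1) * ((τ : ℂ) ^ 2 + 4 * Real.pi * I) / Real.pi‖ ≤ 5 := by
    have h4 : ‖(τ : ℂ) ^ (m + 1)‖ ≤ 1 := by
      rw [norm_pow, h0]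
      exact pow_le_one₀ hτ.le (by linarith)
    have h5 : ‖(τ : ℂ) ^ 2 + 4 * Real.pi * I‖ ≤ 5 * Real.pi := by
      refine (norm_add_le _ _).trans ?_
      rw [norm_pow, h0, norm_mul, norm_mul, norm_I, norm_real,
        Real.norm_of_nonneg Real.pi_pos.le]
      norm_num
      nlinarith [Real.pi_gt_three]
    rw [norm_div, norm_mul, norm_real, Real.norm_of_nonneg Real.pi_pos.le,
      div_le_iff₀ Real.pi_pos]
    nlinarith [norm_nonneg ((τ : ℂ) ^ 2 + 4 * Real.pi * I)]
  have h6 : ‖exp (-L / 2) ^ (m + 3)‖ ≤ 4 / 3 * (11 / 10) ^ m := by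
    rw [norm_pow]
    refine (pow_le_pow_left₀ (norm_nonneg _) h.norm_exp_le _).trans ?_
    rw [pow_add]
    have : (0 : ℝ) ≤ (11 / 10) ^ m := by positivity
    norm_num
    linarith
  have h7 : (1 : ℝ) ≤ (11 / 10) ^ m := one_le_pow₀ (by norm_num)
  rw [h.A_eq]
  refine (norm_add_le _ _).trans ?_
  rw [norm_mul, norm_mul]
  have h8 : ‖(τ : ℂ) ^ (m + 1) * ((τ : ℂ) ^ 2 + 4 * Real.pi * I) / Real.pi‖
      * ‖I / (((m : ℂ) + 2) * 2 ^ (m + 3))‖ * ‖((1 + s) ^ (m + 2))⁻¹‖ ≤ 5 * (1 / 16) * 1 := by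
    gcongr
  linarith

end SaddleData

lemma tendsto_B_zero : Tendsto (B 0) (𝓝[>] 0) (𝓝 1) := by
  refine isSeriesIn_B_zero.tendsto ?_
  simpa using (Real.continuous_sqrt.tendsto 0).mono_left nhdsWithin_le_nhds

lemma tendsto_A (m : ℕ) : Tendsto (A (m + 2)) (𝓝[>] 0) (𝓝 1) :=
  (isSeriesIn_A m).tendsto (tendsto_id.mono_left nhdsWithin_le_nhds)

/-- The τ-independent majorant for letting τ → 0 under the sum over m. -/
lemma SaddleData.norm_A_sub_one_mul_le {τ : ℝ} {s L : ℂ} (h : SaddleData τ s L) (m : ℕ) :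
    ‖A (m + 2) τ - 1‖ * (1 / 2) ^ m ≤ 8 * (11 / 20) ^ m := by
  have h1 : ‖A (m + 2) τ - 1‖ ≤ 8 * (11 / 10) ^ m := by
    refine (norm_sub_le _ _).trans ?_
    have h7 : (1 : ℝ) ≤ (11 / 10) ^ m := one_le_pow₀ (by norm_num)
    rw [norm_one]
    linarith [h.norm_A_le m]
  calc _ ≤ 8 * (11 / 10) ^ m * (1 / 2 : ℝ) ^ m := by gcongr
    _ = _ := by rw [mul_assoc, ← mul_pow]; norm_num

lemma summable_majorant (C : ℝ) : Summable fun n : ℕ => C * (11 / 20 : ℝ) ^ n :=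
  (summable_geometric_of_lt_one (by norm_num) (by norm_num)).mul_left C

lemma eleven_twentieths_pow (n : ℕ) :
    (11 / 20 : ℝ) ^ n = (11 / 10) ^ n * 2 ^ n * (1 / 4) ^ n := by
  rw [← mul_pow, ← mul_pow]
  norm_num

lemma eventually_wBound_ampSeries : ∃ K, ∀ᶠ τ : ℝ in 𝓝[>] 0, WBound (ampSeries τ) K := by
  refine ⟨∑' n : ℕ, 2 * (‖Ring.choose (-5 / 2 : ℂ) n‖ * (11 / 20) ^ n), ?_⟩
  filter_upwards [eventually_saddleData,
    tendsto_B_zero.norm.eventually_lt_const (show ‖(1 : ℂ)‖ < 2 by norm_num)] with τ h h0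
  refine WBound.of_le (summable_norm_choose.mul_left 2) fun n => ?_
  have hB : ‖B n τ‖ ≤ 2 * (11 / 10) ^ n := by
    cases n with
    | zero => simpa using h0.le
    | succ n => exact h.norm_B_succ_le n
  rw [coeff_ampSeries, norm_mul, norm_mul, norm_pow, norm_mul, norm_eps, Complex.norm_two]
  calc _ ≤ (2 * (11 / 10) ^ n) * ‖Ring.choose (-5 / 2 : ℂ) n‖ * (2 * 1) ^ n * (1 / 4) ^ n := by
        gcongr
    _ = 2 * (‖Ring.choose (-5 / 2 : ℂ) n‖ * (11 / 20) ^ n) := by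
        rw [eleven_twentieths_pow]
        ring

lemma eventually_wBound_expSeries : ∃ K, ∀ᶠ τ : ℝ in 𝓝[>] 0, WBound (expSeries τ) K := by
  refine ⟨∑' n : ℕ, 56 * (11 / 20 : ℝ) ^ n, ?_⟩
  filter_upwards [eventually_saddleData] with τ h
  refine WBound.of_le (summable_majorant 56) fun n => ?_
  cases n with
  | zero => rw [coeff_expSeries_zero]; norm_num
  | succ n =>
    have hA : ‖A (n + 3) τ‖ ≤ 7 * (11 / 10) ^ (n + 1) := h.norm_A_le (n + 1)
    rw [coeff_expSeries_succ, norm_mul, norm_mul, norm_pow, norm_mul, norm_eps, norm_neg,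
      Complex.norm_two, norm_div, norm_mul, norm_I, norm_real, Real.norm_of_nonneg Real.pi_pos.le,
      Complex.norm_two]
    have hpi := Real.pi_le_four
    calc Real.pi * 1 / 2 * ‖A (n + 3) τ‖ * (2 * 1) ^ (n + 3) * (1 / 4) ^ (n + 1)
        ≤ 4 * 1 / 2 * (7 * (11 / 10) ^ (n + 1)) * (2 * 1) ^ (n + 3) * (1 / 4) ^ (n + 1) := by
          gcongr
      _ = 56 * (11 / 20) ^ (n + 1) := by
          rw [eleven_twentieths_pow]
          ring

/-- The exponent as a power series in `x`. -/
lemma hasSum_exponent {τ K : ℝ} (hW : WBound (expSeries τ) K) {x : ℝ} (hx : |x| ≤ 1 / 4) :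
    HasSum (fun m : ℕ => -2 * Real.pi * (A (m + 2) τ * (-2 * eps * x) ^ m))
      (evalSeries (expSeries τ) x - 2 * Real.pi * A 2 τ) := by
  have h1 : HasSum (fun n => PowerSeries.coeff n (expSeries τ) * (x : ℂ) ^ n)
      (evalSeries (expSeries τ) x) := (hW.summable_norm hx).of_norm.hasSum
  rw [← hasSum_nat_add_iff' 1] at h1 ⊢
  convert! h1 using 1
  · funext m
    rw [coeff_expSeries_succ, mul_pow (-2 * eps), show (-2 * eps) ^ (m + 3)
      = 4 * eps ^ 2 * (-2 * eps) ^ (m + 1) by ring, eps_sq]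
    linear_combination (-2 * Real.pi * A (m + 3) τ * (-2 * eps) ^ (m + 1) * (x : ℂ) ^ (m + 1)) * I_sq
  · simp [coeff_expSeries_zero]

/-- The real part of the exponent is bounded away from zero, uniformly in `τ`. -/
lemma eventually_re_evalSeries_le : ∀ᶠ τ : ℝ in 𝓝[>] 0, ∀ x : ℝ, |x| ≤ 1 / 4 →
    (evalSeries (expSeries τ) x).re ≤ (2 * Real.pi * A 2 τ).re - 1 / 2 := by
  -- Dominated convergence: the total deviation of the A_n from 1, with weights 2^{-m}, tends to 0.
  -- The weights match |2εx| ≤ 1/2.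
  have hδ : Tendsto (fun τ => ∑' m : ℕ, ‖A (m + 2) τ - 1‖ * (1 / 2) ^ m) (𝓝[>] 0)
      (𝓝 (∑' m : ℕ, (0 : ℝ))) := by
    refine tendsto_tsum_of_dominated_convergence (summable_majorant 8) (fun m => ?_) ?_
    · have := ((tendsto_A m).sub_const 1).norm.mul_const ((1 / 2 : ℝ) ^ m)
      simpa using this
    · filter_upwards [eventually_saddleData] with τ h m
      rw [Real.norm_of_nonneg (by positivity)]
      exact h.norm_A_sub_one_mul_le m
  rw [tsum_zero] at hδ
  obtain ⟨K, hK⟩ := eventually_wBound_expSeries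
  -- The tolerance 1/9 is half of the lower bound 2/9 for Re 1/(1-y) below; what remains is 2π/9 >
  -- 1/2.
  filter_upwards [eventually_saddleData, hK,
    hδ.eventually_lt_const (show (0 : ℝ) < 1 / 9 by norm_num)] with τ h hW hδ x hx
  set y : ℂ := -2 * eps * x with hy
  have hyn : ‖y‖ ≤ 1 / 2 := by
    rw [hy, norm_mul, norm_mul, norm_neg, norm_eps, norm_real, Real.norm_eq_abs, Complex.norm_two]
    linarith
  have hle : ∀ m : ℕ, ‖(A (m + 2) τ - 1) * y ^ m‖ ≤ ‖A (m + 2) τ - 1‖ * (1 / 2) ^ m := by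
    intro m
    rw [norm_mul, norm_pow]
    gcongr
  have hs1 : Summable fun m : ℕ => ‖A (m + 2) τ - 1‖ * (1 / 2) ^ m :=
    Summable.of_nonneg_of_le (fun m => by positivity) h.norm_A_sub_one_mul_le (summable_majorant 8)
  have hs2 : Summable fun m : ℕ => ‖(A (m + 2) τ - 1) * y ^ m‖ :=
    Summable.of_nonneg_of_le (fun m => norm_nonneg _) hle hs1
  have hS : ‖∑' m : ℕ, (A (m + 2) τ - 1) * y ^ m‖ < 1 / 9 :=
    ((norm_tsum_le_tsum_norm hs2).trans (hs2.tsum_le_tsum hle hs1)).trans_lt hδ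
  have hsum := (hs2.of_norm.hasSum.add
    (hasSum_geometric_of_norm_lt_one (show ‖y‖ < 1 by linarith))).mul_left (-2 * Real.pi : ℂ)
  have heq := (hasSum_exponent hW hx).unique (hsum.congr_fun fun m => by ring)
  set S := ∑' m : ℕ, (A (m + 2) τ - 1) * y ^ m
  -- From |y| ≤ 1/2: Re(1-y) ≥ 1/2 and |1-y|² ≤ 9/4, with quotient 2/9.
  have hre : 2 / 9 ≤ ((1 - y)⁻¹).re := by
    have h1 : 1 / 2 ≤ (1 - y).re := by
      have := (abs_le.1 (abs_re_le_norm y)).2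
      rw [sub_re, one_re]
      linarith
    have h2 : ‖1 - y‖ ≤ 3 / 2 := (norm_sub_le _ _).trans (by rw [norm_one]; linarith)
    have h3 : normSq (1 - y) ≤ 9 / 4 := by
      rw [normSq_eq_norm_sq]
      nlinarith [norm_nonneg (1 - y)]
    have h4 : 0 < normSq (1 - y) := normSq_pos.2 fun h => by rw [h] at h1; norm_num at h1
    rw [inv_re, le_div_iff₀ h4]
    linarith
  have hSre := (abs_le.1 ((abs_re_le_norm S).trans hS.le)).1
  have hfin := congrArg re heq
  rw [sub_re, show (-2 * Real.pi : ℂ) = ((-2 * Real.pi : ℝ) : ℂ) by push_cast; ring, re_ofReal_mul,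
    add_re] at hfin
  nlinarith [Real.pi_gt_three]

/-! ### Reduction of J₂ to the normalized integral. -/

lemma cutPow_sub_natCast {z : ℂ} (hz : z ≠ 0) (a : ℂ) (n : ℕ) :
    cutPow z (a - n) = cutPow z a / z ^ n := by
  rw [cutPow, cutPow, sub_mul, exp_sub, exp_nat_mul, exp_cutLog hz]

lemma eps_cubed : eps ^ 3 = I * eps := by
  rw [pow_succ, eps_sq]

lemma eventually_deriv_phase_eq_zero : ∀ᶠ τ in 𝓝[>] (0 : ℝ), deriv (phase τ) (q₂ τ) = 0 := by
  filter_upwards [eventually_isSecondSaddle_iff, eventually_q₂_eq] with τ h h1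
  exact ((h _).2 h1).1

namespace SaddleData

variable {τ : ℝ} {s L : ℂ}

/-- The radius 3τ/10 exceeds the half-length τ/4 of the segment and is below the height of the
saddle, about τ/2. So the Taylor series at the saddle converge along the segment. -/
lemma im_pos_of_mem_ball (h : SaddleData τ s L) {z : ℂ}
    (hz : z ∈ Metric.ball (q₂ τ) (3 * τ / 10)) : 0 < z.im := by
  have h1 : ‖z - q₂ τ‖ < 3 * τ / 10 := by simpa [dist_eq] using hz
  have h2 := (abs_lt.1 ((abs_im_le_norm _).trans_lt h1)).1
  have h3 := (abs_lt.1 ((abs_re_le_norm _).trans_lt h.near)).1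
  rw [sub_im, h.q_eq, show (I * s).im = s.re by simp] at h2
  rw [sub_re, show ((τ : ℂ) / 2).re = τ / 2 by simp] at h3
  linarith [h.pos]

lemma mem_ball (h : SaddleData τ s L) {x : ℝ} (hx : |x| ≤ 1 / 4) :
    q₂ τ + eps ^ 3 * τ * x ∈ Metric.ball (q₂ τ) (3 * τ / 10) := by
  have hτ := h.pos
  rw [Metric.mem_ball, dist_eq, add_sub_cancel_left, norm_mul, norm_mul, norm_pow, norm_eps,
    norm_real, norm_real, Real.norm_eq_abs, Real.norm_eq_abs, abs_of_pos hτ]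
  nlinarith

/-- The Taylor series of f at the saddle, rescaled: ε³τx = (iτ/2)(2εx) because ε³ = iε. -/
lemma evalSeries_ampSeries (h : SaddleData τ s L) {x : ℝ} (hx : |x| ≤ 1 / 4) :
    evalSeries (ampSeries τ) x
      = 4 / cutPow (I * τ / 2) (-5 / 2) * f (q₂ τ + eps ^ 3 * τ * x) := by
  have hd : DifferentiableOn ℂ f (Metric.ball (q₂ τ) (3 * τ / 10)) := fun z hz =>
    (((hasDerivAt_cutPow (-5 / 2) (h.im_pos_of_mem_ball hz)).const_mul (1 / 4)).const_add
      1).differentiableAt.differentiableWithinAt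
  have hsum := (hasSum_taylorSeries_on_ball hd (h.mem_ball hx)).mul_left
    (4 / cutPow (I * τ / 2) (-5 / 2))
  rw [evalSeries, ← hsum.tsum_eq]
  refine tsum_congr fun n => ?_
  have hτ := h.tau_ne_zero
  have hz : I * (τ : ℂ) / 2 ≠ 0 := by simp [hτ]
  have hfac : (n.factorial : ℂ) ≠ 0 := by exact_mod_cast n.factorial_ne_zero
  have hch := choose_ne_zero n
  have hc := cutPow_ne_zero (I * τ / 2) (-5 / 2)
  have hx' : (eps ^ 3 * τ * x) ^ n = (I * τ / 2) ^ n * ((2 * eps) ^ n * (x : ℂ) ^ n) := by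
    rw [← mul_pow, ← mul_pow, eps_cubed]
    ring
  rw [coeff_ampSeries, B, cutPow_sub_natCast hz, add_sub_cancel_left, smul_eq_mul, smul_eq_mul, hx']
  have hzn := pow_ne_zero n hz
  generalize (I * (τ : ℂ) / 2) ^ n = Z at *
  generalize cutPow (I * τ / 2) (-5 / 2) = D at *
  generalize Ring.choose (-5 / 2 : ℂ) n = R at *
  generalize (2 * eps) ^ n = U
  field_simp

/-- The Taylor series of the phase, rescaled: (2i/τ)(ε³τx) = -2εx, and the quadratic factor supplies
x²/τ. The direction ε³ makes the leading term -2πA_2x²/τ, nearly real and negative. -/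
lemma phase_eq (h : SaddleData τ s L) (hd0 : deriv (phase τ) (q₂ τ) = 0) {K : ℝ}
    (hW : WBound (expSeries τ) K) {x : ℝ} (hx : |x| ≤ 1 / 4) :
    phase τ (q₂ τ + eps ^ 3 * τ * x) = phase τ (q₂ τ)
      + (x ^ 2 / τ : ℝ) * (evalSeries (expSeries τ) x - 2 * Real.pi * A 2 τ) := by
  have hd : DifferentiableOn ℂ (phase τ) (Metric.ball (q₂ τ) (3 * τ / 10)) := fun z hz =>
    (hasDerivAt_phase τ (h.im_pos_of_mem_ball hz)).differentiableAt.differentiableWithinAt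
  have hsum := hasSum_taylorSeries_on_ball hd (h.mem_ball hx)
  -- The two terms split off are the value at the saddle and the first-order term, which vanishes.
  rw [← hasSum_nat_add_iff' 2] at hsum
  have hexp := (hasSum_exponent hW hx).mul_left ((x ^ 2 / τ : ℝ) : ℂ)
  have hτ := h.tau_ne_zero
  have hpi : (Real.pi : ℂ) ≠ 0 := by exact_mod_cast Real.pi_ne_zero
  have heq := hsum.unique (hexp.congr_fun fun m => ?_)
  · simp only [Finset.sum_range_succ, Finset.sum_range_zero, iteratedDeriv_zero, iteratedDeriv_one,
      hd0] at heq
    simp at heq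
    push_cast
    linear_combination heq
  · have hfac : ((m + 2).factorial : ℂ) ≠ 0 := by exact_mod_cast Nat.factorial_ne_zero _
    have hI : (2 * I / (τ : ℂ)) ^ (m + 2 + 1) ≠ 0 := pow_ne_zero _ (by simp [hτ])
    have hA : iteratedDeriv (m + 2) (phase τ) (q₂ τ) = A (m + 2) τ
        * (Real.pi * (2 * I / (τ : ℂ)) ^ (m + 2 + 1) * ((m + 2).factorial : ℂ)) / 4 := by
      rw [A]
      field_simp
    have hx' : (2 * I / (τ : ℂ)) ^ (m + 2 + 1) * (eps ^ 3 * τ * x) ^ (m + 2)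
        = 2 * I / τ * ((-2 * eps * x) ^ m * (4 * I * x ^ 2)) := by
      have e1 : 2 * I / (τ : ℂ) * (eps ^ 3 * τ * x) = -2 * eps * x := by
        rw [eps_cubed]
        field_simp
        linear_combination (eps * x) * I_sq
      rw [pow_succ, mul_right_comm, ← mul_pow, e1, pow_add, show (-2 * eps * (x : ℂ)) ^ 2
        = 4 * eps ^ 2 * x ^ 2 by ring, eps_sq]
      ring
    rw [hA, add_sub_cancel_left, smul_eq_mul, smul_eq_mul]
    have e2 : ((m + 2).factorial : ℂ)⁻¹ * ((eps ^ 3 * τ * x) ^ (m + 2) * (A (m + 2) τ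
        * (Real.pi * (2 * I / (τ : ℂ)) ^ (m + 2 + 1) * ((m + 2).factorial : ℂ)) / 4))
        = A (m + 2) τ * Real.pi / 4
          * ((2 * I / (τ : ℂ)) ^ (m + 2 + 1) * (eps ^ 3 * τ * x) ^ (m + 2)) := by
      generalize (2 * I / (τ : ℂ)) ^ (m + 2 + 1) = Z
      generalize (eps ^ 3 * τ * (x : ℂ)) ^ (m + 2) = Y
      field_simp
    rw [e2, hx']
    push_cast
    field_simp
    linear_combination (A (m + 2) τ * x ^ 2 * (-2 * eps * x) ^ m) * I_sq

end SaddleData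

/-- The substitution x = t/2 - 1/4, the segment having direction vector ε³τ/2. -/
lemma J₂_eq_integral (τ : ℝ) : J₂ τ = 2 * Real.pi * (eps ^ 3 * τ
    * ∫ x in (-(1 / 4) : ℝ)..(1 / 4), f (q₂ τ + eps ^ 3 * τ * x)
      * exp (phase τ (q₂ τ + eps ^ 3 * τ * x))) := by
  have h := intervalIntegral.integral_comp_mul_sub (a := 0) (b := 1)
    (fun x : ℝ => f (q₂ τ + eps ^ 3 * τ * x) * exp (phase τ (q₂ τ + eps ^ 3 * τ * x)))
    (show (1 / 2 : ℝ) ≠ 0 by norm_num) (1 / 4)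
  norm_num at h
  rw [J₂, segmentIntegral, intervalIntegral.integral_mul_const]
  have h2 : ∀ t : ℝ, q₂Minus τ + t * (q₂Plus τ - q₂Minus τ)
      = q₂ τ + eps ^ 3 * τ * ((1 / 2 * t - 1 / 4 : ℝ) : ℂ) := by
    intro t
    rw [q₂Minus, q₂Plus]
    push_cast
    ring
  simp only [h2]
  push_cast
  rw [h, q₂Minus, q₂Plus]
  ring

/-- The factor relating `J₂` to the normalized integral. -/
def prefactor (τ : ℝ) : ℂ :=
  2 * Real.pi * eps ^ 3 * τ * (cutPow (I * τ / 2) (-5 / 2) / 4) * exp (phase τ (q₂ τ))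

lemma SaddleData.J₂_eq {τ : ℝ} {s L : ℂ} (h : SaddleData τ s L)
    (hd0 : deriv (phase τ) (q₂ τ) = 0) {K : ℝ} (hW : WBound (expSeries τ) K) :
    J₂ τ = prefactor τ * ∫ x in (-(1 / 4) : ℝ)..(1 / 4), evalSeries (ampSeries τ) x
      * exp ((x ^ 2 / τ : ℝ) * (evalSeries (expSeries τ) x - 2 * Real.pi * A 2 τ)) := by
  have hc := cutPow_ne_zero (I * τ / 2) (-5 / 2)
  have h1 : (∫ x in (-(1 / 4) : ℝ)..(1 / 4), f (q₂ τ + eps ^ 3 * τ * x)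
      * exp (phase τ (q₂ τ + eps ^ 3 * τ * x)))
      = ∫ x in (-(1 / 4) : ℝ)..(1 / 4), (cutPow (I * τ / 2) (-5 / 2) / 4 * exp (phase τ (q₂ τ))) *
      (evalSeries (ampSeries τ) x
      * exp ((x ^ 2 / τ : ℝ) * (evalSeries (expSeries τ) x - 2 * Real.pi * A 2 τ))) := by
    refine intervalIntegral.integral_congr fun x hx => ?_
    rw [Set.uIcc_of_le (by norm_num)] at hx
    have hx' : |x| ≤ 1 / 4 := abs_le.2 hx
    rw [h.evalSeries_ampSeries hx', h.phase_eq hd0 hW hx', exp_add]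
    generalize cutPow (I * τ / 2) (-5 / 2) = D at *
    field_simp
  rw [J₂_eq_integral, h1, intervalIntegral.integral_const_mul, prefactor]
  ring

/-! ### The constants, and the expansion of J₂. -/

/-- On the slit plane the principal logarithm respects inversion, and scaling by a positive real
adds its real logarithm; this separates √(τ/2) from the principal root of A_2. -/
lemma ofReal_div_cpow_half {r : ℝ} (hr : 0 < r) {z : ℂ} (hz : z ∈ slitPlane) :
    ((r : ℂ) / z) ^ (1 / 2 : ℂ) = (Real.sqrt r : ℂ) / z ^ (1 / 2 : ℂ) := by
  have hz0 := slitPlane_ne_zero hz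
  have hr0 : (r : ℂ) ≠ 0 := by exact_mod_cast hr.ne'
  have h1 : (Real.sqrt r : ℂ) = exp (Real.log r / 2) := by
    rw [← Real.exp_log (Real.sqrt_pos.2 hr), Real.log_sqrt hr.le]
    push_cast
    rfl
  rw [cpow_def_of_ne_zero (div_ne_zero hr0 hz0), cpow_def_of_ne_zero hz0, div_eq_mul_inv,
    log_ofReal_mul hr (inv_ne_zero hz0), log_inv _ (slitPlane_arg_ne_pi hz), h1, ← exp_sub]
  congr 1
  ring

lemma momentSum_eq {τ : ℝ} (hB : B 0 τ ≠ 0) (N : ℕ) :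
    momentSum (ampSeries τ) (expSeries τ) (2 * Real.pi * A 2 τ) τ N
      = Real.sqrt Real.pi * B 0 τ * ∑ n ∈ Finset.range N, F n τ * (τ : ℂ) ^ n := by
  have hspi : (Real.sqrt Real.pi : ℂ) ≠ 0 := by
    exact_mod_cast (Real.sqrt_pos.2 Real.pi_pos).ne'
  rw [momentSum, Finset.mul_sum]
  refine Finset.sum_congr rfl fun n _ => ?_
  rw [F, ← mul_assoc, mul_div_cancel₀ _ (mul_ne_zero hspi hB)]
  rfl

lemma exp_phase_eq (τ : ℝ) :
    exp (phase τ (q₂ τ)) = exp (Real.pi * I * (1 / τ - 1 / 8)) * E τ := by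
  rw [E, mul_div_cancel₀ _ (exp_ne_zero _)]

lemma ofReal_sqrt_sq {τ : ℝ} (hτ : 0 < τ) : (Real.sqrt τ : ℂ) ^ 2 = τ := by
  exact_mod_cast Real.sq_sqrt hτ.le

lemma cutPow_eq {τ : ℝ} (hτ : 0 < τ) :
    cutPow (I * τ / 2) (-5 / 2) / 4 = -2 / ((1 + I) * (Real.sqrt τ : ℂ) ^ 5) := by
  have h := inv_cutPow_eq hτ
  rw [← inv_inj, inv_div, h, inv_div]
  ring

lemma one_add_I_eq : 1 + I = (Real.sqrt 2 : ℂ) * eps := by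
  have h0 : (Real.sqrt 2 : ℂ) ≠ 0 := by
    exact_mod_cast (Real.sqrt_pos.2 (by norm_num : (0 : ℝ) < 2)).ne'
  rw [eps_eq]
  field_simp

/-- The quotient ε³/(1+i) equals i/√2; with the sign of `cutPow_eq` it gives the factor -i =
e^{-πi/2} that turns the phase -1/8 into -5/8. -/
lemma prefactor_mul_sqrt {τ : ℝ} (hτ : 0 < τ) :
    prefactor τ * Real.sqrt (τ / 2) = 2 * Real.pi / τ * exp (Real.pi * I * (1 / τ - 5 / 8)) * E τ := by
  have h0 : (Real.sqrt 2 : ℂ) ≠ 0 := by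
    exact_mod_cast (Real.sqrt_pos.2 (by norm_num : (0 : ℝ) < 2)).ne'
  have h1 : (Real.sqrt τ : ℂ) ≠ 0 := by exact_mod_cast (Real.sqrt_pos.2 hτ).ne'
  have hs2 := ofReal_sqrt_sq (τ := 2) (by norm_num)
  have he : eps ≠ 0 := exp_ne_zero _
  have hexp : exp (Real.pi * I * (1 / τ - 5 / 8)) = -I * exp (Real.pi * I * (1 / τ - 1 / 8)) := by
    rw [← exp_neg_pi_div_two_mul_I, ← exp_add]
    ring_nf
  have hτS := ofReal_sqrt_sq hτ
  rw [prefactor, exp_phase_eq, cutPow_eq hτ, one_add_I_eq, hexp, Real.sqrt_div hτ.le, ← hτS,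
    ← eps_sq]
  push_cast
  rw [show ((2 : ℝ) : ℂ) = 2 by norm_num] at hs2
  generalize exp (Real.pi * I * (1 / (Real.sqrt τ : ℂ) ^ 2 - 1 / 8)) = X
  field_simp
  linear_combination E τ * hs2

/-- The exponential e^{πi(1/τ - 1/8)} has modulus 1, so τ·τ^{-5/2}·√τ = 1/τ sets the size. -/
lemma norm_prefactor_le {τ : ℝ} (hτ : 0 < τ) (hE : ‖E τ‖ ≤ 2) :
    ‖prefactor τ‖ * Real.sqrt τ ≤ 8 * Real.pi / τ := by
  have hS := Real.sqrt_pos.2 hτ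
  have hSS := Real.sq_sqrt hτ.le
  have h1 : ‖exp (phase τ (q₂ τ))‖ ≤ 2 := by
    rw [exp_phase_eq, norm_mul, show Real.pi * I * (1 / τ - 1 / 8 : ℂ)
      = ((Real.pi * (1 / τ - 1 / 8) : ℝ) : ℂ) * I by push_cast; ring, norm_exp_ofReal_mul_I, one_mul]
    exact hE
  have h2 : ‖cutPow (I * τ / 2) (-5 / 2) / 4‖ ≤ 2 / Real.sqrt τ ^ 5 := by
    rw [cutPow_eq hτ, norm_div, norm_neg, Complex.norm_two, norm_mul, norm_pow, norm_real,
      Real.norm_of_nonneg hS.le, one_add_I_eq, norm_mul, norm_eps, norm_real,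
      Real.norm_of_nonneg (Real.sqrt_nonneg _), mul_one]
    have h3 : (1 : ℝ) ≤ Real.sqrt 2 := Real.one_le_sqrt.2 (by norm_num)
    refine div_le_div_of_nonneg_left (by norm_num) (by positivity) ?_
    exact le_mul_of_one_le_left (by positivity) h3
  rw [prefactor, norm_mul, norm_mul, norm_mul, norm_mul, norm_mul, norm_pow, norm_eps, norm_real,
    norm_real, Real.norm_of_nonneg Real.pi_pos.le, Real.norm_of_nonneg hτ.le, Complex.norm_two]
  have hpi := Real.pi_pos
  calc _ ≤ 2 * Real.pi * 1 ^ 3 * τ * (2 / Real.sqrt τ ^ 5) * 2 * Real.sqrt τ := by gcongr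
    _ = 8 * Real.pi / τ := by
        rw [show Real.sqrt τ ^ 5 = (Real.sqrt τ ^ 2) ^ 2 * Real.sqrt τ by ring, hSS]
        field_simp
        ring

lemma J₂_expansion (N : ℕ) :
    (fun τ : ℝ => J₂ τ - 2 * Real.pi / τ * exp (Real.pi * I * (1 / τ - 5 / 8))
        * (B 0 τ * E τ * (∑ n ∈ Finset.range N, F n τ * (τ : ℂ) ^ n) / (A 2 τ) ^ (1 / 2 : ℂ)))
      =O[𝓝[>] (0 : ℝ)] fun τ : ℝ => τ ^ ((N : ℤ) - 1) := by
  obtain ⟨K, hK⟩ := eventually_wBound_ampSeries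
  obtain ⟨K', hK'⟩ := eventually_wBound_expSeries
  have hE : ∀ᶠ τ in 𝓝[>] (0 : ℝ), ‖E τ‖ < 2 :=
    (isSeriesIn_E.tendsto (tendsto_id.mono_left nhdsWithin_le_nhds)).norm.eventually_lt_const
      (by norm_num)
  have hA : ∀ᶠ τ in 𝓝[>] (0 : ℝ), A 2 τ ∈ slitPlane :=
    (tendsto_A 0).eventually_mem (isOpen_slitPlane.mem_nhds one_mem_slitPlane)
  refine IsBigO.of_bound (8 * Real.pi * (laplaceConst K K' N * Real.sqrt (4 * Real.pi))) ?_
  filter_upwards [eventually_saddleData, eventually_deriv_phase_eq_zero, hK, hK', hE, hA,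
    eventually_re_evalSeries_le, eventually_A_two_ne_zero_and_B_zero_ne_zero]
    with τ h hd hW hW' hE hA hre hAB
  have hτ := h.pos
  have hpi : (Real.pi : ℂ) ≠ 0 := by exact_mod_cast Real.pi_ne_zero
  have hspi : (Real.sqrt Real.pi : ℂ) ≠ 0 := by
    exact_mod_cast (Real.sqrt_pos.2 Real.pi_pos).ne'
  have hlap := laplace_expansion hW hW' (coeff_expSeries_zero τ) hτ hre N
  -- With a = 2πA_2 the Gaussian factor is √(τ/2)/√A_2; the normalization of F_n by √π·B_0 cancels
  -- the rest.
  have hmain : (Real.pi / (2 * Real.pi * A 2 τ / τ)) ^ (1 / 2 : ℂ) / Real.sqrt Real.pi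
      * momentSum (ampSeries τ) (expSeries τ) (2 * Real.pi * A 2 τ) τ N
      = Real.sqrt (τ / 2) * (B 0 τ * (∑ n ∈ Finset.range N, F n τ * (τ : ℂ) ^ n)
        / (A 2 τ) ^ (1 / 2 : ℂ)) := by
    have h1 : (Real.pi : ℂ) / (2 * Real.pi * A 2 τ / τ) = ((τ / 2 : ℝ) : ℂ) / A 2 τ := by
      have := hAB.1
      have := h.tau_ne_zero
      push_cast
      field_simp
    rw [h1, ofReal_div_cpow_half (by linarith) hA, momentSum_eq hAB.2]
    field_simp
  rw [hmain] at hlap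
  have heq : J₂ τ - 2 * Real.pi / τ * exp (Real.pi * I * (1 / τ - 5 / 8))
        * (B 0 τ * E τ * (∑ n ∈ Finset.range N, F n τ * (τ : ℂ) ^ n) / (A 2 τ) ^ (1 / 2 : ℂ))
      = prefactor τ * ((∫ x in (-(1 / 4) : ℝ)..(1 / 4), evalSeries (ampSeries τ) x
      * exp ((x ^ 2 / τ : ℝ) * (evalSeries (expSeries τ) x - 2 * Real.pi * A 2 τ)))
        - Real.sqrt (τ / 2) * (B 0 τ * (∑ n ∈ Finset.range N, F n τ * (τ : ℂ) ^ n)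
        / (A 2 τ) ^ (1 / 2 : ℂ))) := by
    rw [h.J₂_eq hd hW']
    linear_combination (B 0 τ * (∑ n ∈ Finset.range N, F n τ * (τ : ℂ) ^ n)
      / (A 2 τ) ^ (1 / 2 : ℂ)) * prefactor_mul_sqrt hτ
  have hC : 0 ≤ laplaceConst K K' N := by
    have h1 := hW.nonneg
    have h2 := hW'.nonneg
    have h3 := truncConst_nonneg (M := 2 * N) h1 h2
    rw [laplaceConst]
    positivity
  rw [heq, norm_mul, Real.norm_of_nonneg (by positivity), zpow_sub_one₀ hτ.ne', zpow_natCast]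
  calc _ ≤ ‖prefactor τ‖ * (laplaceConst K K' N * Real.sqrt (4 * Real.pi) * τ ^ N * Real.sqrt τ) := by
        gcongr
    _ = (‖prefactor τ‖ * Real.sqrt τ) * (laplaceConst K K' N * Real.sqrt (4 * Real.pi) * τ ^ N) := by
        ring
    _ ≤ 8 * Real.pi / τ * (laplaceConst K K' N * Real.sqrt (4 * Real.pi) * τ ^ N) :=
        mul_le_mul_of_nonneg_right (norm_prefactor_le hτ hE.le) (by positivity)
    _ = _ := by ring

end

end NaiveIntegral

open NaiveIntegral in
theorem mainTheorem3 :
    -- the second saddle exists and is unique for small `τ`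
    (∀ᶠ τ in 𝓝[>] (0 : ℝ), ∃! q : ℂ, IsSecondSaddle τ q) ∧
    -- the asymptotic expansion of `J₂`
    (∀ N : ℕ,
      (fun τ : ℝ =>
          J₂ τ - 2 * Real.pi / τ * Complex.exp (Real.pi * I * (1 / τ - 5 / 8))
            * (B 0 τ * E τ * (∑ n ∈ Finset.range N, F n τ * (τ : ℂ) ^ n)
                / (A 2 τ) ^ (1 / 2 : ℂ)))
        =O[𝓝[>] (0 : ℝ)] fun τ : ℝ => τ ^ ((N : ℤ) - 1)) ∧
    -- the factors are convergent series in `τ` or in `τ^{1/2}`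
    IsSeriesIn (fun τ => τ) 1 E ∧
    (∀ n : ℕ, 2 ≤ n → IsSeriesIn (fun τ => τ) 1 (A n)) ∧
    IsSeriesIn Real.sqrt 1 (B 0) ∧
    (∀ n : ℕ, 1 ≤ n → IsSeriesIn (fun τ => τ) 1 (B n)) ∧
    (∀ n : ℕ, ∃ c₀ : ℂ, IsSeriesIn Real.sqrt c₀ (F n)) ∧
    -- their first terms
    ((fun τ : ℝ => E τ - (1 + (1 / 8 - 47 * I * Real.pi / 96) * τ
          + (144 - 3432 * I * Real.pi - 2209 * (Real.pi : ℂ) ^ 2) / 18432 * (τ : ℂ) ^ 2))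
        =O[𝓝[>] (0 : ℝ)] fun τ : ℝ => τ ^ 3) ∧
    ((fun τ : ℝ => A 2 τ - (1 - τ + (-31 / 32 - 3 * I / (8 * Real.pi)) * (τ : ℂ) ^ 2))
        =O[𝓝[>] (0 : ℝ)] fun τ : ℝ => τ ^ 3) ∧
    ((fun τ : ℝ => B 0 τ - (1 - 5 / 8 * τ
          - 5 * (27 * Real.pi + 8 * I) / (128 * Real.pi) * (τ : ℂ) ^ 2
          - (1 / 2 + I / 2) * ((τ ^ (5 / 2 : ℝ) : ℝ) : ℂ)))
        =O[𝓝[>] (0 : ℝ)] fun τ : ℝ => τ ^ 3) ∧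
    (∀ᶠ τ in 𝓝[>] (0 : ℝ), F 0 τ = 1 ∧
      F 1 τ = -(15 * I * A 3 τ * B 1 τ) / (4 * Real.pi * A 2 τ ^ 2 * B 0 τ)
        + 35 * I * B 2 τ / (8 * Real.pi * A 2 τ * B 0 τ)
        + 15 * I * A 3 τ ^ 2 / (8 * Real.pi * A 2 τ ^ 3)
        - 3 * I * A 4 τ / (2 * Real.pi * A 2 τ ^ 2) ∧
      F 2 τ = 1575 * A 3 τ ^ 3 * B 1 τ / (32 * (Real.pi : ℂ) ^ 2 * A 2 τ ^ 5 * B 0 τ)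
        - 3675 * A 3 τ ^ 2 * B 2 τ / (64 * (Real.pi : ℂ) ^ 2 * A 2 τ ^ 4 * B 0 τ)
        - 525 * A 4 τ * A 3 τ * B 1 τ / (8 * (Real.pi : ℂ) ^ 2 * A 2 τ ^ 4 * B 0 τ)
        + 1575 * A 3 τ * B 3 τ / (32 * (Real.pi : ℂ) ^ 2 * A 2 τ ^ 3 * B 0 τ)
        + 75 * A 5 τ * B 1 τ / (4 * (Real.pi : ℂ) ^ 2 * A 2 τ ^ 3 * B 0 τ)
        + 525 * A 4 τ * B 2 τ / (16 * (Real.pi : ℂ) ^ 2 * A 2 τ ^ 3 * B 0 τ)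
        - 3465 * B 4 τ / (128 * (Real.pi : ℂ) ^ 2 * A 2 τ ^ 2 * B 0 τ)
        - 3465 * A 3 τ ^ 4 / (128 * (Real.pi : ℂ) ^ 2 * A 2 τ ^ 6)
        + 945 * A 4 τ * A 3 τ ^ 2 / (16 * (Real.pi : ℂ) ^ 2 * A 2 τ ^ 5)
        - 105 * A 5 τ * A 3 τ / (4 * (Real.pi : ℂ) ^ 2 * A 2 τ ^ 4)
        - 105 * A 4 τ ^ 2 / (8 * (Real.pi : ℂ) ^ 2 * A 2 τ ^ 4)
        + 15 * A 6 τ / (2 * (Real.pi : ℂ) ^ 2 * A 2 τ ^ 3)) := by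
  refine ⟨eventually_existsUnique_isSecondSaddle, J₂_expansion, isSeriesIn_E, ?_,
    isSeriesIn_B_zero, ?_, exists_isSeriesIn_F, E_expansion, A_two_expansion, B_zero_expansion, ?_⟩
  · intro n hn
    obtain ⟨m, rfl⟩ := Nat.exists_eq_add_of_le' hn
    exact isSeriesIn_A m
  · intro n hn
    obtain ⟨m, rfl⟩ := Nat.exists_eq_add_of_le' hn
    exact isSeriesIn_B m
  · filter_upwards [eventually_A_two_ne_zero_and_B_zero_ne_zero] with τ h
    exact ⟨F_zero_eq h.2, F_one_eq h.1 h.2, F_two_eq h.1 h.2⟩
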